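/- Let $\vartheta\in(0,\pi/2)$, and let $p_0=(\cos\vartheta,0)$, $p_1=(0,\sin\vartheta)$, $p_2=(-\cos\vartheta,0)$, $p_3=(0,-\sin\vartheta)$ be the vertices of the rhombus of side $1$ with angle $2\vartheta$ at $p_0$ and $p_2$, so that the diagonals $p_0p_2$ and $p_1p_3$ have lengths $2\cos\vartheta$ and $2\sin\vartheta$. The rhombic Vicsek fractal $K_\vartheta$ is the unique non-empty compact set with $K_\vartheta=\bigcup_{i}w_i(K_\vartheta)$, where $w_1,\dots,w_5$ are the homotheties of ratio $1/3$ centred at the centre of the rhombus and at its four vertices. Let $V_0=\{p_0,\dots,p_3\}$ (the essential fixed points), let $E_0$ be the set of ordered pairs $e=(e^+,e^-)$ of distinct elements of $V_0$, and put $\ell(e)=|e^+-e^-|$. For a word $\sigma$ of length $|\sigma|=n$ let $w_\sigma=w_{\sigma(1)}\circ\dots\circ w_{\sigma(n)}$. The discrete spectral triple on $K_\vartheta$ is given by $\mathcal H=\bigoplus_{\sigma}\ell^2(E_0)$ (sum over all finite words), $\pi(f)\delta_{\sigma,e}=f(w_\sigma(e^+))\,\delta_{\sigma,e}$, $|D|\delta_{\sigma,e}=3^{|\sigma|}\ell(e)^{-1}\delta_{\sigma,e}$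 and $D=F|D|$, where the self-adjoint unitary $F$ sends $\delta_{\sigma,(p,q)}$ to $\delta_{\sigma,(q,p)}$; $[D,f]$ stands for $D\pi(f)-\pi(f)D$. The Vicsek square is $K_{\pi/4}$, and $\varphi_\vartheta(x,y)=(\sqrt2\cos\vartheta\,x,\sqrt2\sin\vartheta\,y)$ is the affine map carrying its vertices to those of the rhombus. For symmetric positive conductances $c$ on $E_0$ put $\mathcal E[u]=\sum_{(p,q)\in E_0}c_{pq}|u(p)-u(q)|^2$ and $S_n(\mathcal E)[g]=\sum_{|\sigma|=n}\mathcal E[g\circ w_\sigma]$; $\mathcal E$ is an eigenform with eigenvalue $\rho>0$ if $\inf\{S_1(\mathcal E)[g]: g|_{V_0}=u\}=\rho\,\mathcal E[u]$ for all $u:V_0\to\mathbb R$, and its self-similar energy is $\mathcal E_\infty[g]=\lim_n\rho^{-n}S_n(\mathcal E)[g]\in[0,\infty]$. Set $$H(\vartheta)=\frac{2+\sqrt{1+\tan^2\vartheta}}{2+\sqrt{1+\cot^2\vartheta}} .$$ Then, for every $\vartheta\in(0,\pi/2)$, $\varphi_\vartheta(K_{\pi/4})=K_\vartheta$; the form $\widehat{\mathcal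 E}$ on the vertices of the Vicsek square with conductances $(1,1,1,1,H,H^{-1})$, $H=H(\vartheta)$ (namely $1$ on the sides, $H$ on the diagonal that $\varphi_\vartheta$ maps to the diagonal of length $2\cos\vartheta$, $H^{-1}$ on the other diagonal) is an eigenform with eigenvalue $1/3$; the limit defining $\widehat{\mathcal E}_\infty[g]$ exists in $[0,\infty]$ for every continuous $g$ on $K_{\pi/4}$; and there is a constant $c>0$ such that for every continuous $f$ on $K_\vartheta$ with $\widehat{\mathcal E}_\infty[f\circ\varphi_\vartheta]<\infty$ the operator $|[D,f]|^2|D|^{-s}$ is trace class for all $s>1$ and $$\operatorname{Res}_{s=1}\operatorname{tr}\big(|[D,f]|^2|D|^{-s}\big)=\lim_{s\to1^+}(s-1)\operatorname{tr}\big(|[D,f]|^2|D|^{-s}\big)=c\,\widehat{\mathcal E}_\infty[f\circ\varphi_\vartheta].$$ Moreover, for every $H>0$ there is exactly one $\vartheta\in(0,\pi/2)$ with $H(\vartheta)=H$. -/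

import Mathlib

open Filter Topology
open scoped ENNReal NNReal lp

noncomputable section

namespace RhombicVicsek

/-! ### The fractal -/

/-- The Euclidean plane. -/
abbrev Plane : Type := EuclideanSpace ℝ (Fin 2)

/-- Vertices of the rhombus of side `1` centred at the origin. The angle at `vertex ϑ 0` and at
`vertex ϑ 2` is `2ϑ`; the diagonal joining `0` and `2` has length `2 cos ϑ`, the one joining
`1` and `3` has length `2 sin ϑ`. -/
def vertex (ϑ : ℝ) : Fin 4 → Plane :=
  ![!₂[Real.cos ϑ, 0], !₂[0, Real.sin ϑ], !₂[-Real.cos ϑ, 0], !₂[0, -Real.sin ϑ]]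

/-- Fixed points of the five similarities: the centre (index `0`) and the four vertices. -/
def fixedPt (ϑ : ℝ) : Fin 5 → Plane :=
  ![0, vertex ϑ 0, vertex ϑ 1, vertex ϑ 2, vertex ϑ 3]

/-- The five similarities with ratio `1/3`. -/
def sim (ϑ : ℝ) (i : Fin 5) (x : Plane) : Plane :=
  fixedPt ϑ i + (1 / 3 : ℝ) • (x - fixedPt ϑ i)

/-- `K` is the self-similar fractal of the family `w`: a non-empty compact set with
`K = ⋃ i, w i (K)`. -/
def IsSelfSimilarFractal (w : Fin 5 → Plane → Plane) (K : Set Plane) : Prop :=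
  K.Nonempty ∧ IsCompact K ∧ K = ⋃ i, w i '' K

theorem sim_lipschitz (ϑ : ℝ) (i : Fin 5) : LipschitzWith (1 / 3 : ℝ≥0) (sim ϑ i) := by
  refine LipschitzWith.of_dist_le_mul fun x y => ?_
  have h : sim ϑ i x - sim ϑ i y = (1 / 3 : ℝ) • (x - y) := by
    simp only [sim]; module
  rw [dist_eq_norm, dist_eq_norm, h, norm_smul]
  simp

/-- The set map `K ↦ ⋃ i, w i (K)` on non-empty compact sets. -/
def hutchinson (ϑ : ℝ) (K : TopologicalSpace.NonemptyCompacts Plane) :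
    TopologicalSpace.NonemptyCompacts Plane where
  carrier := ⋃ i, sim ϑ i '' K
  isCompact' := isCompact_iUnion fun i => K.isCompact.image (sim_lipschitz ϑ i).continuous
  nonempty' := Set.nonempty_iUnion.2 ⟨0, K.nonempty.image _⟩

theorem hutchinson_contracting (ϑ : ℝ) : ContractingWith (1 / 3 : ℝ≥0) (hutchinson ϑ) := by
  refine ⟨by rw [← NNReal.coe_lt_coe]; norm_num, fun A B => ?_⟩
  change Metric.hausdorffEDist (⋃ i, sim ϑ i '' (A : Set Plane)) (⋃ i, sim ϑ i '' (B : Set Plane))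
    ≤ _ * Metric.hausdorffEDist (A : Set Plane) (B : Set Plane)
  refine Metric.hausdorffEDist_iUnion_le.trans (iSup_le fun i => ?_)
  have key : ∀ A B : TopologicalSpace.NonemptyCompacts Plane, ∀ x ∈ sim ϑ i '' (A : Set Plane),
      ∃ y ∈ sim ϑ i '' (B : Set Plane), edist x y ≤
        ((1 / 3 : ℝ≥0) : ℝ≥0∞) * Metric.hausdorffEDist (A : Set Plane) (B : Set Plane) := by
    rintro A B _ ⟨x, hx, rfl⟩
    obtain ⟨y, hy, hxy⟩ := B.isCompact.exists_infEDist_eq_edist B.nonempty x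
    refine ⟨_, ⟨y, hy, rfl⟩, (sim_lipschitz ϑ i x y).trans ?_⟩
    gcongr
    rw [← hxy]
    exact Metric.infEDist_le_hausdorffEDist_of_mem hx
  refine Metric.hausdorffEDist_le_of_mem_edist (key A B) ?_
  intro x hx
  rw [Metric.hausdorffEDist_comm]
  exact key B A x hx

theorem existsUnique_fractal (ϑ : ℝ) : ∃! K : Set Plane, IsSelfSimilarFractal (sim ϑ) K := by
  have : Nonempty (TopologicalSpace.NonemptyCompacts Plane) :=
    ⟨⟨⟨{0}, isCompact_singleton⟩, by simp⟩⟩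
  have hc := hutchinson_contracting ϑ
  let K := ContractingWith.fixedPoint (hutchinson ϑ) hc
  have hK : hutchinson ϑ K = K := hc.fixedPoint_isFixedPt
  refine ⟨K, ⟨K.nonempty, K.isCompact,
    (congrArg (fun S : TopologicalSpace.NonemptyCompacts Plane => (S : Set Plane)) hK).symm⟩, ?_⟩
  rintro L ⟨hn, hcp, hL⟩
  let L' : TopologicalSpace.NonemptyCompacts Plane := ⟨⟨L, hcp⟩, hn⟩
  have hfix : Function.IsFixedPt (hutchinson ϑ) L' := SetLike.coe_injective hL.symm
  exact congrArg (fun S : TopologicalSpace.NonemptyCompacts Plane => (S : Set Plane))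
    (hc.fixedPoint_unique hfix)

/-- The rhombic Vicsek fractal with angle `2ϑ`. -/
def fractal (ϑ : ℝ) : Set Plane := (existsUnique_fractal ϑ).choose

theorem fractal_spec (ϑ : ℝ) : IsSelfSimilarFractal (sim ϑ) (fractal ϑ) :=
  (existsUnique_fractal ϑ).choose_spec.1

/-- The essential fixed points of the family of similarities. -/
def essentialFixedPoints (ϑ : ℝ) : Set Plane :=
  {x | ∃ i, x = fixedPt ϑ i ∧
    ∃ i' j j', i' ≠ i ∧ sim ϑ j (fixedPt ϑ i) = sim ϑ j' (fixedPt ϑ i')}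

/-- The set `V₀` of essential fixed points consists of the four vertices, so that it may be indexed
by `Fin 4` through `vertex`. -/
theorem essentialFixedPoints_eq {ϑ : ℝ} (h : ϑ ∈ Set.Ioo 0 (Real.pi / 2)) :
    essentialFixedPoints ϑ = Set.range (vertex ϑ) := by
  have hs : 0 < Real.sin ϑ := Real.sin_pos_of_pos_of_lt_pi h.1 (by linarith [h.2, Real.pi_pos])
  have hc : 0 < Real.cos ϑ := Real.cos_pos_of_mem_Ioo ⟨by linarith [h.1, Real.pi_pos], h.2⟩
  ext x
  constructor
  · rintro ⟨i, rfl, i', j, j', hne, he⟩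
    refine Fin.cases (motive := fun i => i' ≠ i → sim ϑ j (fixedPt ϑ i) = sim ϑ j' (fixedPt ϑ i') →
      fixedPt ϑ i ∈ Set.range (vertex ϑ)) ?_ (fun k _ _ => ⟨k, by fin_cases k <;> rfl⟩) i hne he
    intro hne he
    exfalso
    have h0 := congrArg (fun p : Plane => p 0) he
    have h1 := congrArg (fun p : Plane => p 1) he
    fin_cases i' <;> fin_cases j <;> fin_cases j' <;>
      simp [sim, fixedPt, vertex] at hne h0 h1 <;> linarith
  · rintro ⟨k, rfl⟩
    refine ⟨k.succ, by fin_cases k <;> rfl, (k + 2).succ, 0, k.succ, ?_, ?_⟩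
    · fin_cases k <;> decide
    · ext l
      fin_cases k <;> fin_cases l <;> simp [sim, fixedPt, vertex] <;> ring

/-- Words of length `n` in the five symbols. -/
abbrev Word (n : ℕ) : Type := Fin n → Fin 5

/-- `w_σ = w_{σ(1)} ∘ ⋯ ∘ w_{σ(n)}`. -/
def wordMap (ϑ : ℝ) : (n : ℕ) → Word n → Plane → Plane
  | 0, _ => id
  | n + 1, σ => sim ϑ (σ 0) ∘ wordMap ϑ n (Fin.tail σ)

/-- `E₀`: ordered pairs of distinct vertices. -/
abbrev Edge₀ : Type := {e : Fin 4 × Fin 4 // e.1 ≠ e.2}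

/-- The affine map carrying the square (`ϑ = π/4`) to the rhombus. -/
def deform (ϑ : ℝ) (x : Plane) : Plane :=
  !₂[√2 * Real.cos ϑ * x 0, √2 * Real.sin ϑ * x 1]

/-! ### Quadratic forms on `V₀`, eigenforms and self-similar energies -/

/-- `𝓔[u] = ∑_{(p,q) ∈ E₀} c_{pq} |u(p) - u(q)|²`, for real or complex functions on `V₀`. -/
def form {𝕜 : Type} [RCLike 𝕜] (c : Fin 4 → Fin 4 → ℝ) (u : Fin 4 → 𝕜) : ℝ :=
  ∑ e : Edge₀, c e.1.1 e.1.2 * ‖u e.1.1 - u e.1.2‖ ^ 2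

/-- `S_n(𝓔)[f] = ∑_{|σ| = n} 𝓔[f ∘ w_σ]`. Only the values of `f` on `V_n` matter. -/
def formSum {𝕜 : Type} [RCLike 𝕜] (ϑ : ℝ) (c : Fin 4 → Fin 4 → ℝ) (n : ℕ) (f : Plane → 𝕜) : ℝ :=
  ∑ σ : Word n, form c fun i => f (wordMap ϑ n σ (vertex ϑ i))

/-- The form with conductances `c` is an eigenform with eigenvalue `ρ`: `c` is symmetric and
positive, `ρ > 0`, and for every `u ∈ C(V₀)` the infimum of `S₁(𝓔)[g]` over the extensions `g`
of `u` is `ρ 𝓔[u]`. -/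
def IsEigenform (ϑ : ℝ) (c : Fin 4 → Fin 4 → ℝ) (ρ : ℝ) : Prop :=
  (∀ i j, i ≠ j → c i j = c j i ∧ 0 < c i j) ∧ 0 < ρ ∧
    ∀ u : Fin 4 → ℝ,
      IsGLB {t | ∃ g : Plane → ℝ, (∀ i, g (vertex ϑ i) = u i) ∧ t = formSum ϑ c 1 g}
        (ρ * form c u)

/-- `𝓔_∞[f] = lim_n ρ^{-n} S_n(𝓔)[f] ∈ [0, ∞]` (written as an upper limit, so as to be defined
for all `f`). -/
def limitEnergy (ϑ : ℝ) (c : Fin 4 → Fin 4 → ℝ) (ρ : ℝ) (f : Plane → ℂ) : ℝ≥0∞ :=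
  limsup (fun n : ℕ => ENNReal.ofReal ((ρ ^ n)⁻¹ * formSum ϑ c n f)) atTop

/-- Conductances `(1, 1, 1, 1, H, H⁻¹)`: `1` on the sides, `H` on the diagonal joining `0` and `2`,
`H⁻¹` on the diagonal joining `1` and `3`. The values for `i = j` play no role. -/
def vicsekConductance (H : ℝ) : Fin 4 → Fin 4 → ℝ :=
  !![0, 1, H, 1;
     1, 0, 1, H⁻¹;
     H, 1, 0, 1;
     1, H⁻¹, 1, 0]

/-- The parameter `H` attached to the angle. -/
def paramH (ϑ : ℝ) : ℝ :=
  (2 + √(1 + Real.tan ϑ ^ 2)) / (2 + √(1 + Real.cot ϑ ^ 2))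

/-! ### Unbounded operators -/

/-- Product of unbounded operators on its natural domain `{x ∈ dom S | S x ∈ dom T}`. -/
def opComp {H : Type} [AddCommGroup H] [Module ℂ H] (T S : H →ₗ.[ℂ] H) : H →ₗ.[ℂ] H :=
  T.comp (S.domRestrict ((T.domain.comap S.toFun).map S.domain.subtype)) (by
    rintro ⟨x, ⟨⟨y, hy⟩, hyT, rfl⟩, hx⟩
    exact hyT)

/-- `|T|² = T*T`, computed with the closure of `T`. -/
def absSq {H : Type} [NormedAddCommGroup H] [InnerProductSpace ℂ H] [CompleteSpace H]
    (T : H →ₗ.[ℂ] H) : H →ₗ.[ℂ] H :=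
  opComp T.closure.adjoint T.closure

/-- `A` is an everywhere defined bounded positive trace class operator with trace `t`. -/
def HasTrace {H : Type} [NormedAddCommGroup H] [InnerProductSpace ℂ H] [CompleteSpace H]
    (A : H →ₗ.[ℂ] H) (t : ℝ) : Prop :=
  ∃ B : H →L[ℂ] H, B.IsPositive ∧ A = (B : H →ₗ[ℂ] H).toPMap ⊤ ∧
    ∀ (ι : Type) (b : HilbertBasis ι ℂ H),
      HasSum (fun i => inner ℂ (b i) (B (b i))) (t : ℂ)

/-- Multiplication by `a` on `ℓ²(ι)`, on its maximal domain. -/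
def diagOp {ι : Type} (a : ι → ℂ) : ℓ²(ι, ℂ) →ₗ.[ℂ] ℓ²(ι, ℂ) where
  domain :=
    { carrier := {ξ | Memℓp (fun i => a i * ξ i) 2}
      add_mem' := fun {ξ η} hξ hη => by
        have h := Memℓp.add hξ hη
        refine (congrArg (fun g : ι → ℂ => Memℓp g 2) ?_).mp h
        funext i
        simp [mul_add]
      zero_mem' := by
        have h : (fun i => a i * (0 : ℓ²(ι, ℂ)) i) = 0 := by
          funext i
          simp
        change Memℓp (fun i => a i * (0 : ℓ²(ι, ℂ)) i) 2
        rw [h]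
        exact zero_memℓp
      smul_mem' := fun k ξ hξ => by
        have h := Memℓp.const_smul (𝕜 := ℂ) hξ k
        refine (congrArg (fun g : ι → ℂ => Memℓp g 2) ?_).mp h
        funext i
        simp [mul_left_comm] }
  toFun :=
    { toFun := fun ξ => ⟨fun i => a i * ξ.1 i, ξ.2⟩
      map_add' := fun ξ η => by
        ext i
        exact mul_add _ _ _
      map_smul' := fun k ξ => by
        ext i
        exact mul_left_comm _ _ _ }

/-! ### The discrete spectral triple -/

/-- Orthonormal basis of the Hilbert space `⨁_σ ⨁_{e ∈ E₀} ℓ²(e)`: pairs of a word `σ` and an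
oriented edge `e ∈ E₀`. -/
abbrev Edge : Type := (Σ n : ℕ, Word n) × Edge₀

/-- The Hilbert space of the triple. -/
abbrev Hilb : Type := ℓ²(Edge, ℂ)

/-- `w_σ(e⁺)`. -/
def Edge.src (ϑ : ℝ) (e : Edge) : Plane := wordMap ϑ e.1.1 e.1.2 (vertex ϑ e.2.1.1)

/-- The length of the edge `w_σ(e)`, equal to `3^{-|σ|} ℓ(e)`. -/
def Edge.length (ϑ : ℝ) (e : Edge) : ℝ :=
  (1 / 3 : ℝ) ^ e.1.1 * dist (vertex ϑ e.2.1.1) (vertex ϑ e.2.1.2)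

/-- The same edge with the opposite orientation. -/
def Edge.rev (e : Edge) : Edge := (e.1, ⟨(e.2.1.2, e.2.1.1), e.2.2.symm⟩)

theorem Edge.rev_injective : Function.Injective Edge.rev :=
  Function.LeftInverse.injective (g := Edge.rev) fun _ => rfl

/-- The unitary `F` sending each oriented edge to the opposite one. -/
def edgeFlip : Hilb →ₗ[ℂ] Hilb where
  toFun ξ := ⟨fun e => ξ e.rev, by
    have h := (memℓp_gen_iff (p := 2) (by norm_num)).1 (lp.memℓp ξ)
    exact (memℓp_gen_iff (p := 2) (by norm_num)).2 (h.comp_injective Edge.rev_injective)⟩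
  map_add' _ _ := rfl
  map_smul' _ _ := rfl

/-- `|D|`, the diagonal operator with entries `ℓ(e)⁻¹`. -/
def absDirac (ϑ : ℝ) : Hilb →ₗ.[ℂ] Hilb := diagOp fun e => ((e.length ϑ)⁻¹ : ℝ)

/-- `|D|^{-s}`. -/
def absDiracPow (ϑ s : ℝ) : Hilb →ₗ.[ℂ] Hilb := diagOp fun e => (((e.length ϑ)⁻¹ ^ (-s) : ℝ) : ℂ)

/-- The Dirac operator `D = F |D|`. -/
def dirac (ϑ : ℝ) : Hilb →ₗ.[ℂ] Hilb := edgeFlip.compPMap (absDirac ϑ)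

/-- The action `π(f)` of functions: multiplication by `f(w_σ(e⁺))`. -/
def rep (ϑ : ℝ) (f : Plane → ℂ) : Hilb →ₗ.[ℂ] Hilb := diagOp fun e => f (e.src ϑ)

/-- The commutator `[D, f] = D π(f) - π(f) D`. -/
def diracCommutator (ϑ : ℝ) (f : Plane → ℂ) : Hilb →ₗ.[ℂ] Hilb :=
  opComp (dirac ϑ) (rep ϑ f) - opComp (rep ϑ f) (dirac ϑ)

/-- The operator `|[D,f]|² |D|^{-s}`. -/
def zetaOperator (ϑ : ℝ) (f : Plane → ℂ) (s : ℝ) : Hilb →ₗ.[ℂ] Hilb :=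
  opComp (absSq (diracCommutator ϑ f)) (absDiracPow ϑ s)

end RhombicVicsek

end

/-! For every `H > 0` the form with conductances `(1, 1, 1, 1, H, H⁻¹)` equals
`2 (|δ u|² + (1 + H) |u₀ - u₂|² + (1 + H⁻¹) |u₁ - u₃|²)`, where the defect
`δ u = u₀ + u₂ - u₁ - u₃` measures the deviation from being affine. Splitting each diagonal into its
three cells and comparing `δ u` with the defect of the central cell shows that passing to the next
level multiplies the form by at least `1/3`, and that the slack in this inequality controls the
defects of the smaller cells.

The operator `|[D, f]|² |D|^{-s}` is diagonal, and its trace is, up to the factors `ℓ(e)^(s-1)`,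
which tend to `1`, the power series `∑ τₙ (3^(1-s))ⁿ` of the level-`n` energies `τₙ` with
conductances `ℓ(e)⁻¹`. By Abel's theorem the residue is `lim τₙ / log 3`. The conductances `ℓ(e)⁻¹`
and `(1, 1, 1, 1, H(ϑ), H(ϑ)⁻¹)` give forms which are proportional up to a multiple of `|δ u|²`,
and for functions of finite energy the total defect contracts by `2/3` from one level to the next,
up to the convergent energy increments, so that it vanishes in the limit. -/

noncomputable section

namespace RhombicVicsek

section Graphs

theorem mem_graph_opComp_iff {H : Type} [AddCommGroup H] [Module ℂ H] {T S : H →ₗ.[ℂ] H}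
    {x z : H} : (x, z) ∈ (opComp T S).graph ↔ ∃ y, (x, y) ∈ S.graph ∧ (y, z) ∈ T.graph := by
  constructor
  · intro h
    obtain ⟨⟨x', hx, hxS⟩, rfl, rfl⟩ := (LinearPMap.mem_graph_iff _).1 h
    obtain ⟨⟨y, hy⟩, hyT, rfl⟩ := hx
    exact ⟨S ⟨y, hy⟩, S.mem_graph ⟨y, hy⟩, T.mem_graph ⟨S ⟨y, hy⟩, hyT⟩⟩
  · rintro ⟨y, hS, hT⟩
    obtain ⟨x', rfl, rfl⟩ := (LinearPMap.mem_graph_iff _).1 hS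
    have hy : S x' ∈ T.domain := LinearPMap.mem_domain_of_mem_graph hT
    exact (LinearPMap.mem_graph_iff _).2
      ⟨⟨x', ⟨x', hy, rfl⟩, x'.2⟩, rfl, T.mem_graph_snd_inj (T.mem_graph ⟨_, hy⟩) hT rfl⟩

theorem mem_graph_sub_iff {R E F : Type*} [Ring R] [AddCommGroup E] [Module R E]
    [AddCommGroup F] [Module R F] {T S : E →ₗ.[R] F} {x : E} {w : F} :
    (x, w) ∈ (T - S).graph ↔ ∃ y z, (x, y) ∈ T.graph ∧ (x, z) ∈ S.graph ∧ w = y - z := by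
  constructor
  · intro h
    obtain ⟨⟨x', hT, hS⟩, rfl, rfl⟩ := (LinearPMap.mem_graph_iff _).1 h
    exact ⟨T ⟨x', hT⟩, S ⟨x', hS⟩, T.mem_graph ⟨x', hT⟩, S.mem_graph ⟨x', hS⟩, rfl⟩
  · rintro ⟨y, z, hT, hS, rfl⟩
    have hx : x ∈ (T - S).domain :=
      ⟨LinearPMap.mem_domain_of_mem_graph hT, LinearPMap.mem_domain_of_mem_graph hS⟩
    obtain ⟨y', z', hT', hS', h⟩ :
        ∃ y' z', (x, y') ∈ T.graph ∧ (x, z') ∈ S.graph ∧ (T - S) ⟨x, hx⟩ = y' - z' :=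
      ⟨T ⟨x, hx.1⟩, S ⟨x, hx.2⟩, T.mem_graph ⟨x, hx.1⟩, S.mem_graph ⟨x, hx.2⟩, rfl⟩
    rw [T.mem_graph_snd_inj hT hT' rfl, S.mem_graph_snd_inj hS hS' rfl, ← h]
    exact (T - S).mem_graph ⟨x, hx⟩

end Graphs

section Diagonal

variable {ι : Type}

theorem mem_graph_diagOp {a : ι → ℂ} {x y : ℓ²(ι, ℂ)} :
    (x, y) ∈ (diagOp a).graph ↔ ∀ i, y i = a i * x i := by
  constructor
  · intro h i
    obtain ⟨x', rfl, rfl⟩ := (LinearPMap.mem_graph_iff _).1 h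
    rfl
  · intro h
    have hx : Memℓp (fun i => a i * x i) 2 := funext h ▸ lp.memℓp y
    exact (LinearPMap.mem_graph_iff _).2 ⟨⟨x, hx⟩, rfl, lp.ext (funext fun i => (h i).symm)⟩

theorem single_mem_graph_diagOp [DecidableEq ι] (a : ι → ℂ) (i : ι) (k : ℂ) :
    (lp.single 2 i k, lp.single 2 i (a i * k)) ∈ (diagOp a).graph := by
  refine mem_graph_diagOp.2 fun j => ?_
  obtain rfl | hj := eq_or_ne j i
  · simp only [lp.single_apply_self]
  · rw [lp.single_apply_ne _ _ _ hj, lp.single_apply_ne _ _ _ hj, mul_zero]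

/-- Multiplication by a bounded family, as a bounded operator on `ℓ²`. -/
def diagCLM (a : ℓ^∞(ι, ℂ)) : ℓ²(ι, ℂ) →L[ℂ] ℓ²(ι, ℂ) :=
  lp.mapCLM 2 (fun i => ContinuousLinearMap.mul ℂ ℂ (a i)) (norm_nonneg a) fun i => by
    simpa only [ContinuousLinearMap.opNorm_mul_apply] using
      lp.norm_apply_le_norm ENNReal.top_ne_zero a i

theorem diagCLM_apply (a : ℓ^∞(ι, ℂ)) (x : ℓ²(ι, ℂ)) (i : ι) : diagCLM a x i = a i * x i := rfl

theorem diagOp_eq_toPMap (a : ℓ^∞(ι, ℂ)) :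
    diagOp a = (diagCLM a : ℓ²(ι, ℂ) →ₗ[ℂ] ℓ²(ι, ℂ)).toPMap ⊤ := by
  refine LinearPMap.eq_of_eq_graph (Submodule.ext fun ⟨x, y⟩ => ?_)
  rw [mem_graph_diagOp, LinearPMap.mem_graph_iff]
  refine ⟨fun h => ⟨⟨x, trivial⟩, rfl, lp.ext (funext fun i => (h i).symm)⟩, ?_⟩
  rintro ⟨x', rfl, rfl⟩ i
  rfl

theorem opComp_diagOp_diagOp (a : ι → ℂ) {b : ι → ℂ} (hb : Memℓp b ∞) :
    opComp (diagOp a) (diagOp b) = diagOp fun i => a i * b i := by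
  refine LinearPMap.eq_of_eq_graph (Submodule.ext fun ⟨x, z⟩ => ?_)
  simp only [mem_graph_opComp_iff, mem_graph_diagOp]
  constructor
  · rintro ⟨y, hy, hz⟩ i
    rw [hz, hy, mul_assoc]
  · refine fun h => ⟨diagCLM ⟨b, hb⟩ x, fun i => rfl, fun i => ?_⟩
    rw [h, mul_assoc, diagCLM_apply]

theorem isPositive_diagCLM {a : ι → ℝ} (ha : Memℓp (fun i => (a i : ℂ)) ∞) (h0 : ∀ i, 0 ≤ a i) :
    (diagCLM ⟨_, ha⟩).IsPositive := by
  rw [ContinuousLinearMap.isPositive_iff_complex]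
  intro x
  have h := lp.hasSum_inner (𝕜 := ℂ) (diagCLM ⟨_, ha⟩ x) x
  have hterm : ∀ i, inner ℂ (diagCLM ⟨_, ha⟩ x i) (x i) = ((a i * ‖x i‖ ^ 2 : ℝ) : ℂ) := by
    intro i
    simp only [diagCLM_apply, RCLike.inner_apply, map_mul, Complex.conj_ofReal, mul_left_comm,
      Complex.mul_conj', Complex.ofReal_mul, Complex.ofReal_pow]
  simp only [hterm] at h
  rw [← h.tsum_eq, ← Complex.ofReal_tsum]
  exact ⟨rfl, tsum_nonneg fun i => mul_nonneg (h0 i) (sq_nonneg _)⟩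

theorem hasSum_norm_sq_hilbertBasis_apply {κ : Type} (b : HilbertBasis κ ℂ ℓ²(ι, ℂ)) (i : ι) :
    HasSum (fun k => ‖b k i‖ ^ 2) 1 := by
  classical
  have h := b.hasSum_inner_mul_inner (lp.single 2 i (1 : ℂ)) (lp.single 2 i (1 : ℂ))
  have hterm : ∀ k, inner ℂ (lp.single 2 i (1 : ℂ)) (b k) * inner ℂ (b k) (lp.single 2 i (1 : ℂ)) =
      ((‖b k i‖ ^ 2 : ℝ) : ℂ) := by
    intro k
    simp only [lp.inner_single_left, lp.inner_single_right, RCLike.inner_apply, map_one, mul_one,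
      one_mul, Complex.mul_conj', Complex.ofReal_pow]
  rw [funext hterm, lp.inner_single_left, lp.single_apply_self, RCLike.inner_apply, map_one,
    one_mul, ← Complex.ofReal_one] at h
  exact Complex.hasSum_ofReal.1 h

theorem hasSum_inner_diagCLM {a : ι → ℝ} (ha : Memℓp (fun i => (a i : ℂ)) ∞)
    (h0 : ∀ i, 0 ≤ a i) (hs : Summable a) {κ : Type} (b : HilbertBasis κ ℂ ℓ²(ι, ℂ)) :
    HasSum (fun k => inner ℂ (b k) (diagCLM ⟨_, ha⟩ (b k))) ((∑' i, a i : ℝ) : ℂ) := by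
  have hcol : ∀ i, HasSum (fun k => a i * ‖b k i‖ ^ 2) (a i) := fun i => by
    simpa only [mul_one] using (hasSum_norm_sq_hilbertBasis_apply b i).mul_left (a i)
  have hsum : Summable fun p : ι × κ => a p.1 * ‖b p.2 p.1‖ ^ 2 := by
    rw [summable_prod_of_nonneg fun p => mul_nonneg (h0 _) (sq_nonneg _)]
    exact ⟨fun i => (hcol i).summable, by simpa only [(hcol _).tsum_eq] using hs⟩
  have htot : HasSum (fun p : ι × κ => a p.1 * ‖b p.2 p.1‖ ^ 2) (∑' i, a i) := by
    rw [hsum.hasSum_iff, hsum.tsum_prod]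
    exact tsum_congr fun i => (hcol i).tsum_eq
  have hrow : ∀ k, HasSum (fun i => ((a i * ‖b k i‖ ^ 2 : ℝ) : ℂ))
      (inner ℂ (b k) (diagCLM ⟨_, ha⟩ (b k))) := fun k => by
    refine (congrArg (HasSum · _) (funext fun i => ?_)).mpr
      (lp.hasSum_inner (𝕜 := ℂ) (b k) (diagCLM ⟨_, ha⟩ (b k)))
    simp only [diagCLM_apply, RCLike.inner_apply, mul_assoc, Complex.mul_conj',
      Complex.ofReal_mul, Complex.ofReal_pow]
  exact ((Equiv.prodComm κ ι).hasSum_iff.2 (Complex.hasSum_ofReal.2 htot)).prod_fiberwise hrow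

theorem hasTrace_diagOp {a : ι → ℝ} (h0 : ∀ i, 0 ≤ a i) (hs : Summable a) :
    HasTrace (diagOp fun i => (a i : ℂ)) (∑' i, a i) := by
  have ha : Memℓp (fun i => (a i : ℂ)) ∞ := by
    refine memℓp_infty ⟨∑' i, a i, ?_⟩
    rintro _ ⟨i, rfl⟩
    simpa only [Complex.norm_real, Real.norm_of_nonneg (h0 i)] using hs.le_tsum i fun j _ => h0 j
  exact ⟨diagCLM ⟨_, ha⟩, isPositive_diagCLM ha h0, diagOp_eq_toPMap ⟨_, ha⟩,
    fun κ b => hasSum_inner_diagCLM ha h0 hs b⟩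

end Diagonal

section WeightedPerm

variable {ι : Type}

/-- `T` is the weighted permutation operator `x ↦ (d i * x (r i))_i` on a domain which contains the
finitely supported vectors, but need not be maximal. -/
structure IsWeightedPerm (T : ℓ²(ι, ℂ) →ₗ.[ℂ] ℓ²(ι, ℂ)) (d : ι → ℂ) (r : Equiv.Perm ι) :
    Prop where
  apply_eq : ∀ {x y}, (x, y) ∈ T.graph → ∀ i, y i = d i * x (r i)
  single_mem : ∀ [DecidableEq ι] (i : ι) (k : ℂ), lp.single 2 i k ∈ T.domain

namespace IsWeightedPerm

variable {T : ℓ²(ι, ℂ) →ₗ.[ℂ] ℓ²(ι, ℂ)} {d : ι → ℂ} {r : Equiv.Perm ι}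

theorem single_mem_graph [DecidableEq ι] (hT : IsWeightedPerm T d r) (i : ι) (k : ℂ) :
    (lp.single 2 i k, lp.single 2 (r.symm i) (d (r.symm i) * k)) ∈ T.graph := by
  obtain ⟨y, hy⟩ := LinearPMap.mem_domain_iff.1 (hT.single_mem i k)
  suffices y = lp.single 2 (r.symm i) (d (r.symm i) * k) from this ▸ hy
  refine lp.ext (funext fun j => ?_)
  rw [hT.apply_eq hy]
  obtain rfl | hj := eq_or_ne j (r.symm i)
  · rw [r.apply_symm_apply, lp.single_apply_self, lp.single_apply_self]
  · have hrj : r j ≠ i := fun h => hj (r.eq_symm_apply.2 h)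
    rw [lp.single_apply_ne _ _ _ hrj, lp.single_apply_ne _ _ _ hj, mul_zero]

theorem apply_eq_of_mem_topologicalClosure (hT : IsWeightedPerm T d r) {x y : ℓ²(ι, ℂ)}
    (hxy : (x, y) ∈ T.graph.topologicalClosure) (i : ι) : y i = d i * x (r i) := by
  have heval : ∀ i, Continuous fun x : ℓ²(ι, ℂ) => x i := fun i =>
    (lp.lipschitzWith_one_eval (E := fun _ : ι => ℂ) 2 i).continuous
  have hclosed : IsClosed {p : ℓ²(ι, ℂ) × ℓ²(ι, ℂ) | p.2 i = d i * p.1 (r i)} :=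
    isClosed_eq ((heval i).comp continuous_snd)
      (continuous_const.mul ((heval (r i)).comp continuous_fst))
  exact closure_minimal (fun p hp => hT.apply_eq hp i) hclosed hxy

theorem isClosable (hT : IsWeightedPerm T d r) : T.IsClosable := by
  refine ⟨T.graph.topologicalClosure.toLinearPMap, (Submodule.toLinearPMap_graph_eq _ ?_).symm⟩
  rintro ⟨u, v⟩ huv (rfl : u = 0)
  refine lp.ext (funext fun i => ?_)
  simpa only [lp.coeFn_zero, Pi.zero_apply, mul_zero] using
    hT.apply_eq_of_mem_topologicalClosure huv i

theorem closure (hT : IsWeightedPerm T d r) : IsWeightedPerm T.closure d r where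
  apply_eq hxy := hT.apply_eq_of_mem_topologicalClosure <| by
    rwa [hT.isClosable.graph_closure_eq_closure_graph]
  single_mem i k := T.le_closure.1 (hT.single_mem i k)

theorem mem_graph_closure_iff (hT : IsWeightedPerm T d r) {x y : ℓ²(ι, ℂ)} :
    (x, y) ∈ T.closure.graph ↔ ∀ i, y i = d i * x (r i) := by
  classical
  refine ⟨hT.closure.apply_eq, fun h => ?_⟩
  have hx := lp.hasSum_single ENNReal.ofNat_ne_top x
  have hy := r.symm.hasSum_iff.2 (lp.hasSum_single ENNReal.ofNat_ne_top y)
  rw [← hT.isClosable.graph_closure_eq_closure_graph]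
  refine mem_closure_of_tendsto (hx.prodMk hy) (Eventually.of_forall fun s => ?_)
  refine T.graph.sum_mem fun i _ => ?_
  simpa only [Function.comp_apply, h (r.symm i), r.apply_symm_apply] using
    hT.single_mem_graph i (x i)

theorem dense_domain (hT : IsWeightedPerm T d r) : Dense (T.domain : Set ℓ²(ι, ℂ)) := by
  classical
  exact fun u => mem_closure_of_tendsto (lp.hasSum_single ENNReal.ofNat_ne_top u)
    (Eventually.of_forall fun s => T.domain.sum_mem fun i _ => hT.single_mem i _)

theorem mem_graph_adjoint_iff (hT : IsWeightedPerm T d r) {y z : ℓ²(ι, ℂ)} :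
    (y, z) ∈ T.adjoint.graph ↔
      ∀ j, z j = starRingEnd ℂ (d (r.symm j)) * y (r.symm j) := by
  classical
  rw [LinearPMap.adjoint_graph_eq_graph_adjoint hT.dense_domain, Submodule.mem_adjoint_iff]
  constructor
  · intro h j
    have hj := sub_eq_zero.1 (h _ _ (hT.single_mem_graph j 1))
    simpa [lp.inner_single_left, mul_comm] using hj.symm
  · intro h u v huv
    rw [sub_eq_zero, lp.inner_eq_tsum, lp.inner_eq_tsum, ← r.symm.tsum_eq]
    refine tsum_congr fun j => ?_
    simp only [hT.apply_eq huv, h j, r.apply_symm_apply, RCLike.inner_apply, map_mul]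
    ring

theorem absSq_eq_diagOp (hT : IsWeightedPerm T d r) :
    absSq T = diagOp fun i => ((‖d (r.symm i)‖ ^ 2 : ℝ) : ℂ) := by
  have hconj : ∀ i, starRingEnd ℂ (d i) * d i = ((‖d i‖ ^ 2 : ℝ) : ℂ) := fun i => by
    rw [Complex.conj_mul', Complex.ofReal_pow]
  refine LinearPMap.eq_of_eq_graph (Submodule.ext fun ⟨x, z⟩ => ?_)
  rw [absSq, mem_graph_opComp_iff, mem_graph_diagOp]
  simp only [hT.mem_graph_closure_iff, hT.closure.mem_graph_adjoint_iff]
  constructor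
  · rintro ⟨y, hy, hz⟩ i
    rw [hz, hy, r.apply_symm_apply, ← mul_assoc, hconj]
  · intro h
    have hmem : Memℓp (fun i => d i * x (r i)) 2 := by
      have hsq : ∀ x : ℓ²(ι, ℂ), Summable fun i => ‖x i‖ ^ 2 := fun x => by
        simpa using (memℓp_gen_iff (by norm_num)).1 (lp.memℓp x)
      rw [memℓp_gen_iff (by norm_num), ← r.symm.summable_iff]
      refine ((hsq x).add (hsq z)).of_nonneg_of_le
        (fun i => Real.rpow_nonneg (norm_nonneg _) _) fun i => ?_
      simp only [Function.comp_apply, r.apply_symm_apply, h i, norm_mul, norm_pow,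
        Complex.norm_real, norm_norm, ENNReal.toReal_ofNat, Real.rpow_ofNat]
      nlinarith [sq_nonneg (‖x i‖ - ‖d (r.symm i)‖ ^ 2 * ‖x i‖),
        sq_nonneg (‖d (r.symm i)‖ * ‖x i‖)]
    refine ⟨⟨_, hmem⟩, fun i => rfl, fun i => ?_⟩
    rw [h, ← hconj, mul_assoc]
    exact congrArg (fun j => _ * (_ * x j)) (r.apply_symm_apply i).symm

end IsWeightedPerm

end WeightedPerm

section SpectralTriple

theorem Edge.rev_involutive : Function.Involutive Edge.rev := fun _ => rfl

theorem Edge.length_rev (ϑ : ℝ) (e : Edge) : e.rev.length ϑ = e.length ϑ := by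
  simp only [Edge.length, Edge.rev, dist_comm]

theorem Edge.length_nonneg (ϑ : ℝ) (e : Edge) : 0 ≤ e.length ϑ :=
  mul_nonneg (by positivity) dist_nonneg

theorem norm_vertex_le (ϑ : ℝ) (i : Fin 4) : ‖vertex ϑ i‖ ≤ 1 := by
  rw [EuclideanSpace.norm_eq, Real.sqrt_le_one]
  fin_cases i <;> simp [vertex, Real.abs_cos_le_one, Real.abs_sin_le_one]

theorem dist_vertex_le (ϑ : ℝ) (i j : Fin 4) : dist (vertex ϑ i) (vertex ϑ j) ≤ 2 := by
  rw [dist_eq_norm]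
  linarith [norm_sub_le (vertex ϑ i) (vertex ϑ j), norm_vertex_le ϑ i, norm_vertex_le ϑ j]

theorem Edge.length_le (ϑ : ℝ) (e : Edge) : e.length ϑ ≤ 2 :=
  calc e.length ϑ ≤ 1 * 2 :=
        mul_le_mul (pow_le_one₀ (by norm_num) (by norm_num)) (dist_vertex_le _ _ _) dist_nonneg
          zero_le_one
    _ = 2 := one_mul 2

theorem mem_graph_dirac {ϑ : ℝ} {x y : Hilb} :
    (x, y) ∈ (dirac ϑ).graph ↔ ∀ e, y e = ((e.length ϑ)⁻¹ : ℝ) * x e.rev := by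
  have hflip : (x, y) ∈ (dirac ϑ).graph ↔ (x, edgeFlip y) ∈ (absDirac ϑ).graph := by
    simp only [LinearPMap.mem_graph_iff]
    refine exists_congr fun u => and_congr_right fun _ => ⟨?_, fun h => ?_⟩
    · rintro rfl
      rfl
    · exact (congrArg edgeFlip h).trans rfl
  rw [hflip, absDirac, mem_graph_diagOp, Edge.rev_involutive.surjective.forall]
  simp only [Edge.length_rev]
  rfl

theorem single_mem_graph_dirac [DecidableEq Edge] (ϑ : ℝ) (e : Edge) (k : ℂ) :
    (lp.single 2 e k, lp.single 2 e.rev (((e.length ϑ)⁻¹ : ℝ) * k)) ∈ (dirac ϑ).graph := by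
  refine mem_graph_dirac.2 fun e' => ?_
  obtain rfl | he := eq_or_ne e' e.rev
  · rw [lp.single_apply_self, Edge.rev_involutive, lp.single_apply_self, Edge.length_rev]
  · have he' : e'.rev ≠ e := fun h => he (h ▸ (Edge.rev_involutive e').symm)
    rw [lp.single_apply_ne _ _ _ he, lp.single_apply_ne _ _ _ he', mul_zero]

/-- The difference quotient of `f` along an oriented edge: the matrix entry of `[D, f]` from the
opposite edge to this one. -/
def diffQuot (ϑ : ℝ) (f : Plane → ℂ) (e : Edge) : ℂ :=
  ((e.length ϑ)⁻¹ : ℝ) * (f (e.rev.src ϑ) - f (e.src ϑ))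

theorem norm_diffQuot_rev (ϑ : ℝ) (f : Plane → ℂ) (e : Edge) :
    ‖diffQuot ϑ f e.rev‖ = ‖diffQuot ϑ f e‖ := by
  rw [diffQuot, diffQuot, Edge.length_rev, Edge.rev_involutive, norm_mul, norm_mul, norm_sub_rev]

theorem isWeightedPerm_diracCommutator (ϑ : ℝ) (f : Plane → ℂ) :
    IsWeightedPerm (diracCommutator ϑ f) (diffQuot ϑ f) Edge.rev_involutive.toPerm where
  apply_eq h e := by
    obtain ⟨y, z, hy, hz, rfl⟩ := mem_graph_sub_iff.1 h
    obtain ⟨u, hu, huy⟩ := mem_graph_opComp_iff.1 hy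
    obtain ⟨v, hv, hvz⟩ := mem_graph_opComp_iff.1 hz
    rw [lp.coeFn_sub, Pi.sub_apply, mem_graph_dirac.1 huy, mem_graph_diagOp.1 hu,
      mem_graph_diagOp.1 hvz, mem_graph_dirac.1 hv, diffQuot, Function.Involutive.coe_toPerm]
    ring
  single_mem e k := LinearPMap.mem_domain_iff.2 ⟨_, mem_graph_sub_iff.2 ⟨_, _,
    mem_graph_opComp_iff.2 ⟨_, single_mem_graph_diagOp _ e k, single_mem_graph_dirac ϑ e _⟩,
    mem_graph_opComp_iff.2 ⟨_, single_mem_graph_dirac ϑ e k, single_mem_graph_diagOp _ _ _⟩, rfl⟩⟩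

theorem zetaOperator_eq_diagOp (ϑ : ℝ) (f : Plane → ℂ) {s : ℝ} (hs : 0 ≤ s) :
    zetaOperator ϑ f s =
      diagOp fun e => ((e.length ϑ ^ s * ‖diffQuot ϑ f e‖ ^ 2 : ℝ) : ℂ) := by
  have hpow : ∀ e : Edge, (e.length ϑ)⁻¹ ^ (-s) = e.length ϑ ^ s := fun e => by
    rw [Real.inv_rpow (e.length_nonneg ϑ), Real.rpow_neg (e.length_nonneg ϑ), inv_inv]
  have hbdd : Memℓp (fun e : Edge => ((e.length ϑ ^ s : ℝ) : ℂ)) ∞ := by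
    refine memℓp_infty ⟨2 ^ s, ?_⟩
    rintro _ ⟨e, rfl⟩
    change ‖((e.length ϑ ^ s : ℝ) : ℂ)‖ ≤ 2 ^ s
    rw [Complex.norm_real, Real.norm_of_nonneg (Real.rpow_nonneg (e.length_nonneg ϑ) s)]
    exact Real.rpow_le_rpow (e.length_nonneg ϑ) (e.length_le ϑ) hs
  simp only [zetaOperator, (isWeightedPerm_diracCommutator ϑ f).absSq_eq_diagOp, absDiracPow, hpow,
    Function.Involutive.toPerm_symm, Function.Involutive.coe_toPerm, norm_diffQuot_rev,
    opComp_diagOp_diagOp _ hbdd, ← Complex.ofReal_mul, mul_comm]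

theorem hasTrace_zetaOperator {ϑ : ℝ} {f : Plane → ℂ} {s : ℝ} (hs : 0 ≤ s)
    (hsum : Summable fun e : Edge => e.length ϑ ^ s * ‖diffQuot ϑ f e‖ ^ 2) :
    HasTrace (zetaOperator ϑ f s) (∑' e : Edge, e.length ϑ ^ s * ‖diffQuot ϑ f e‖ ^ 2) := by
  rw [zetaOperator_eq_diagOp ϑ f hs]
  exact hasTrace_diagOp
    (fun e => mul_nonneg (Real.rpow_nonneg (e.length_nonneg ϑ) s) (sq_nonneg _)) hsum

end SpectralTriple

section Geometry

theorem sin_pos_of_mem_Ioo {ϑ : ℝ} (hϑ : ϑ ∈ Set.Ioo 0 (Real.pi / 2)) : 0 < Real.sin ϑ :=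
  Real.sin_pos_of_mem_Ioo ⟨hϑ.1, hϑ.2.trans (half_lt_self Real.pi_pos)⟩

theorem cos_pos_of_mem_Ioo {ϑ : ℝ} (hϑ : ϑ ∈ Set.Ioo 0 (Real.pi / 2)) : 0 < Real.cos ϑ :=
  Real.cos_pos_of_mem_Ioo ⟨(neg_lt_zero.2 Real.pi_div_two_pos).trans hϑ.1, hϑ.2⟩

/-- The point of the plane with coordinates `p` in the basis of the two half-diagonals of the
rhombus. Level-one vertices have coordinates in `(1/3) ℤ`, which makes their coincidences
decidable. -/
def diagPt (ϑ : ℝ) (p : ℤ × ℤ) : Plane := !₂[Real.cos ϑ * p.1, Real.sin ϑ * p.2]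

/-- The coordinates of the five fixed points with respect to the half-diagonals. -/
def fixedCoord : Fin 5 → ℤ × ℤ := ![(0, 0), (1, 0), (0, 1), (-1, 0), (0, -1)]

theorem diagPt_injective {ϑ : ℝ} (hϑ : ϑ ∈ Set.Ioo 0 (Real.pi / 2)) :
    Function.Injective (diagPt ϑ) := by
  intro p q h
  have h₀ := congrArg (fun x : Plane => x 0) h
  have h₁ := congrArg (fun x : Plane => x 1) h
  exact Prod.ext
    (Int.cast_injective (mul_left_cancel₀ (cos_pos_of_mem_Ioo hϑ).ne' h₀))
    (Int.cast_injective (mul_left_cancel₀ (sin_pos_of_mem_Ioo hϑ).ne' h₁))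

theorem diagPt_fixedCoord (ϑ : ℝ) (i : Fin 5) : diagPt ϑ (fixedCoord i) = fixedPt ϑ i := by
  ext l
  fin_cases i <;> fin_cases l <;> simp [diagPt, fixedCoord, fixedPt, vertex]

theorem fixedPt_succ (ϑ : ℝ) (k : Fin 4) : fixedPt ϑ k.succ = vertex ϑ k := by
  fin_cases k <;> rfl

theorem sim_vertex (ϑ : ℝ) (i : Fin 5) (k : Fin 4) :
    sim ϑ i (vertex ϑ k) = (1 / 3 : ℝ) • diagPt ϑ (2 * fixedCoord i + fixedCoord k.succ) := by
  rw [sim, ← fixedPt_succ, ← diagPt_fixedCoord, ← diagPt_fixedCoord]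
  ext l
  fin_cases l <;> simp [diagPt] <;> ring

theorem sim_succ_vertex (ϑ : ℝ) (k : Fin 4) : sim ϑ k.succ (vertex ϑ k) = vertex ϑ k := by
  rw [sim, fixedPt_succ, sub_self, smul_zero, add_zero]

theorem sim_zero_vertex (ϑ : ℝ) (k : Fin 4) :
    sim ϑ 0 (vertex ϑ k) = sim ϑ k.succ (vertex ϑ (k + 2)) := by
  have hcoord : ∀ k : Fin 4, 2 * fixedCoord 0 + fixedCoord k.succ =
    2 * fixedCoord k.succ + fixedCoord (k + 2).succ := by decide
  rw [sim_vertex, sim_vertex, hcoord]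

theorem deform_diagPt (ϑ : ℝ) (p : ℤ × ℤ) : deform ϑ (diagPt (Real.pi / 4) p) = diagPt ϑ p := by
  have h : ∀ a b : ℝ, √2 * a * (√2 / 2 * b) = a * b := fun a b => by
    linear_combination a * b / 2 * Real.mul_self_sqrt zero_le_two
  ext l
  fin_cases l
  · exact (congrArg _ (congrArg (· * _) Real.cos_pi_div_four)).trans (h _ _)
  · exact (congrArg _ (congrArg (· * _) Real.sin_pi_div_four)).trans (h _ _)

theorem deform_fixedPt (ϑ : ℝ) (i : Fin 5) :
    deform ϑ (fixedPt (Real.pi / 4) i) = fixedPt ϑ i := by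
  rw [← diagPt_fixedCoord, deform_diagPt, diagPt_fixedCoord]

theorem deform_vertex (ϑ : ℝ) (k : Fin 4) : deform ϑ (vertex (Real.pi / 4) k) = vertex ϑ k := by
  rw [← fixedPt_succ, deform_fixedPt, fixedPt_succ]

theorem deform_sim (ϑ : ℝ) (i : Fin 5) (x : Plane) :
    deform ϑ (sim (Real.pi / 4) i x) = sim ϑ i (deform ϑ x) := by
  rw [sim, sim, ← deform_fixedPt ϑ i]
  ext l
  fin_cases l <;> simp [deform] <;> ring

theorem deform_wordMap (ϑ : ℝ) (n : ℕ) (σ : Word n) (x : Plane) :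
    deform ϑ (wordMap (Real.pi / 4) n σ x) = wordMap ϑ n σ (deform ϑ x) := by
  induction n with
  | zero => rfl
  | succ n ih => simp only [wordMap, Function.comp_apply, deform_sim, ih]

theorem continuous_deform (ϑ : ℝ) : Continuous (deform ϑ) := by
  unfold deform
  fun_prop

theorem deform_image_fractal (ϑ : ℝ) : deform ϑ '' fractal (Real.pi / 4) = fractal ϑ := by
  refine (existsUnique_fractal ϑ).unique ?_ (fractal_spec ϑ)
  obtain ⟨hne, hcompact, hself⟩ := fractal_spec (Real.pi / 4)
  refine ⟨hne.image _, hcompact.image (continuous_deform ϑ), ?_⟩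
  conv_lhs => rw [hself]
  simp only [Set.image_iUnion, Set.image_image, deform_sim]

theorem limitEnergy_comp_deform (ϑ : ℝ) (c : Fin 4 → Fin 4 → ℝ) (ρ : ℝ) (f : Plane → ℂ) :
    limitEnergy (Real.pi / 4) c ρ (f ∘ deform ϑ) = limitEnergy ϑ c ρ f := by
  simp only [limitEnergy, formSum, Function.comp_apply, deform_wordMap, deform_vertex]

end Geometry

section Gluing

variable {α : Type*}

/-- Values on the vertices of the five cells of level one which agree where the cells meet:
the vertex `k` of the central cell is the vertex opposite to `k` in the cell at `k`. -/
def IsGlued (a : Fin 5 → Fin 4 → α) : Prop := ∀ k : Fin 4, a 0 k = a k.succ (k + 2)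

theorem isGlued_comp_sim (ϑ : ℝ) (f : Plane → α) : IsGlued fun i j => f (sim ϑ i (vertex ϑ j)) :=
  fun k => congrArg f (sim_zero_vertex ϑ k)

theorem IsGlued.exists_extension {ϑ : ℝ} (hϑ : ϑ ∈ Set.Ioo 0 (Real.pi / 2))
    {a : Fin 5 → Fin 4 → α} (ha : IsGlued a) :
    ∃ g : Plane → α, ∀ i j, g (sim ϑ i (vertex ϑ j)) = a i j := by
  have hcoord : ∀ (i i' : Fin 5) (j j' : Fin 4),
      2 * fixedCoord i + fixedCoord j.succ = 2 * fixedCoord i' + fixedCoord j'.succ →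
      (i = i' ∧ j = j') ∨ (i = 0 ∧ i' = j.succ ∧ j' = j + 2) ∨
        (i' = 0 ∧ i = j'.succ ∧ j = j' + 2) := by decide
  have hfactors : Function.FactorsThrough (fun p : Fin 5 × Fin 4 => a p.1 p.2)
      fun p => sim ϑ p.1 (vertex ϑ p.2) := by
    rintro ⟨i, j⟩ ⟨i', j'⟩ h
    simp only [sim_vertex] at h
    have hlattice := diagPt_injective hϑ (smul_right_injective Plane (by norm_num) h)
    obtain ⟨rfl, rfl⟩ | ⟨rfl, rfl, rfl⟩ | ⟨rfl, rfl, rfl⟩ := hcoord i i' j j' hlattice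
    · rfl
    · exact ha j
    · exact (ha j').symm
  exact ⟨Function.extend _ _ fun _ => a 0 0, fun i j =>
    hfactors.extend_apply (fun _ => a 0 0) (i, j)⟩

end Gluing

section CellSum

variable {α : Type*}

/-- `∑_{|σ| = n} q[f ∘ w_σ]` for a functional `q` of the values on the vertices. -/
def cellSum (ϑ : ℝ) (q : (Fin 4 → α) → ℝ) (n : ℕ) (f : Plane → α) : ℝ :=
  ∑ σ : Word n, q fun i => f (wordMap ϑ n σ (vertex ϑ i))

theorem cellSum_zero (ϑ : ℝ) (q : (Fin 4 → α) → ℝ) (f : Plane → α) :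
    cellSum ϑ q 0 f = q fun i => f (vertex ϑ i) := by
  simp only [cellSum, wordMap, id, Finset.univ_unique, Finset.sum_singleton]

theorem cellSum_succ (ϑ : ℝ) (q : (Fin 4 → α) → ℝ) (n : ℕ) (f : Plane → α) :
    cellSum ϑ q (n + 1) f = ∑ i, cellSum ϑ q n (f ∘ sim ϑ i) := by
  simp only [cellSum]
  rw [← Fintype.sum_prod_type', ← (Fin.consEquiv fun _ : Fin (n + 1) => Fin 5).sum_comp]
  rfl

theorem cellSum_one (ϑ : ℝ) (q : (Fin 4 → α) → ℝ) (f : Plane → α) :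
    cellSum ϑ q 1 f = ∑ i, q fun j => f (sim ϑ i (vertex ϑ j)) := by
  simp only [cellSum_succ, cellSum_zero, Function.comp_apply]

theorem cellSum_nonneg {ϑ : ℝ} {q : (Fin 4 → α) → ℝ} (hq : ∀ u, 0 ≤ q u) (n : ℕ)
    (f : Plane → α) : 0 ≤ cellSum ϑ q n f :=
  Finset.sum_nonneg fun _ _ => hq _

theorem cellSum_le_cellSum_succ {ϑ : ℝ} {q₁ q₂ : (Fin 4 → α) → ℝ}
    (h : ∀ a : Fin 5 → Fin 4 → α, IsGlued a → q₁ (fun k => a k.succ k) ≤ ∑ i, q₂ (a i))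
    (n : ℕ) (f : Plane → α) : cellSum ϑ q₁ n f ≤ cellSum ϑ q₂ (n + 1) f := by
  induction n generalizing f with
  | zero =>
    simpa only [zero_add, cellSum_zero, cellSum_one, sim_succ_vertex]
      using h _ (isGlued_comp_sim ϑ f)
  | succ n ih =>
    rw [cellSum_succ, cellSum_succ _ _ (n + 1)]
    exact Finset.sum_le_sum fun i _ => ih _

end CellSum

section Forms

variable {𝕜 : Type} [RCLike 𝕜]

theorem sum_edge₀ (F : Fin 4 → Fin 4 → ℝ) :
    ∑ e : Edge₀, F e.1.1 e.1.2 = ∑ i, ∑ j, if i ≠ j then F i j else 0 := by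
  rw [← Fintype.sum_prod_type' fun i j => if i ≠ j then F i j else 0,
    ← Finset.sum_filter fun p : Fin 4 × Fin 4 => p.1 ≠ p.2]
  exact (Finset.sum_subtype _ (by simp) fun p : Fin 4 × Fin 4 => F p.1 p.2).symm

theorem norm_sub_sq_le_add {E : Type*} [SeminormedAddCommGroup E] {H : ℝ} (hH : 0 < H) (x y : E) :
    ‖x - y‖ ^ 2 ≤ (1 + H) * ‖x‖ ^ 2 + (1 + H⁻¹) * ‖y‖ ^ 2 :=
  calc ‖x - y‖ ^ 2 ≤ (‖x‖ + ‖y‖) ^ 2 := by gcongr; exact norm_sub_le x y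
    _ = ‖x‖ ^ 2 + 2 * ‖x‖ * ‖y‖ + ‖y‖ ^ 2 := add_sq _ _
    _ ≤ ‖x‖ ^ 2 + (H * ‖x‖ ^ 2 + H⁻¹ * ‖y‖ ^ 2) + ‖y‖ ^ 2 := by
      gcongr; exact two_mul_le_add_mul_sq hH
    _ = (1 + H) * ‖x‖ ^ 2 + (1 + H⁻¹) * ‖y‖ ^ 2 := by ring

/-- The amount by which the parallelogram rule `u 0 + u 2 = u 1 + u 3` fails. Functions which are
affine on the rhombus have no defect. -/
def defect (u : Fin 4 → 𝕜) : 𝕜 := u 0 + u 2 - u 1 - u 3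

theorem form_eq_of_unit_sides {c : Fin 4 → Fin 4 → ℝ} (hc : ∀ i j, c i j = c j i)
    (h01 : c 0 1 = 1) (h12 : c 1 2 = 1) (h23 : c 2 3 = 1) (h30 : c 3 0 = 1) (u : Fin 4 → 𝕜) :
    form c u = 2 * (‖defect u‖ ^ 2 + (1 + c 0 2) * ‖u 0 - u 2‖ ^ 2 +
      (1 + c 1 3) * ‖u 1 - u 3‖ ^ 2) := by
  rw [form, sum_edge₀ fun i j => c i j * ‖u i - u j‖ ^ 2]
  simp only [Fin.sum_univ_four, defect, RCLike.norm_sq_eq_def, map_sub, map_add]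
  simp [hc 1 0, hc 2 1, hc 3 2, hc 0 3, hc 2 0, hc 3 1, h01, h12, h23, h30]
  ring

theorem form_vicsekConductance (H : ℝ) (u : Fin 4 → 𝕜) :
    form (vicsekConductance H) u = 2 * (‖defect u‖ ^ 2 + (1 + H) * ‖u 0 - u 2‖ ^ 2 +
      (1 + H⁻¹) * ‖u 1 - u 3‖ ^ 2) :=
  form_eq_of_unit_sides (c := vicsekConductance H)
    (by intro i j; fin_cases i <;> fin_cases j <;> rfl) rfl rfl rfl rfl u

theorem form_vicsekConductance_nonneg {H : ℝ} (hH : 0 < H) (u : Fin 4 → 𝕜) :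
    0 ≤ form (vicsekConductance H) u := by
  rw [form_vicsekConductance]
  positivity

theorem two_mul_norm_add_sq_add_norm_two_mul_sub_sq (x y : 𝕜) :
    2 * ‖x + y‖ ^ 2 + ‖2 * x - y‖ ^ 2 = 6 * ‖x‖ ^ 2 + 3 * ‖y‖ ^ 2 := by
  simp only [RCLike.norm_sq_eq_def, two_mul, map_add, map_sub]
  ring

theorem two_mul_norm_add_sub_sq_le (x p q : 𝕜) :
    2 * ‖x + (p - q)‖ ^ 2 + 3 * ‖p + q‖ ^ 2 ≤ 6 * (‖x‖ ^ 2 + ‖p‖ ^ 2 + ‖q‖ ^ 2) := by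
  have hpar := parallelogram_law_with_norm 𝕜 p q
  linarith [two_mul_norm_add_sq_add_norm_two_mul_sub_sq x (p - q), sq_nonneg ‖2 * x - (p - q)‖]

theorem le_form_vicsekConductance_arm {H : ℝ} (hH : 0 < H) (u : Fin 4 → 𝕜) (k : Fin 4) :
    2 * (‖defect u‖ ^ 2 + (1 + vicsekConductance H k (k + 2)) * ‖u k - u (k + 2)‖ ^ 2) ≤
      form (vicsekConductance H) u := by
  have h₀ : 0 ≤ (1 + H) * ‖u 0 - u 2‖ ^ 2 := by positivity
  have h₁ : 0 ≤ (1 + H⁻¹) * ‖u 1 - u 3‖ ^ 2 := by positivity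
  rw [form_vicsekConductance]
  fin_cases k
  · change 2 * (_ + (1 + H) * ‖u 0 - u 2‖ ^ 2) ≤ _
    linarith
  · change 2 * (_ + (1 + H⁻¹) * ‖u 1 - u 3‖ ^ 2) ≤ _
    linarith
  · change 2 * (_ + (1 + H) * ‖u 2 - u 0‖ ^ 2) ≤ _
    rw [norm_sub_rev (u 2)]
    linarith
  · change 2 * (_ + (1 + H⁻¹) * ‖u 3 - u 1‖ ^ 2) ≤ _
    rw [norm_sub_rev (u 3)]
    linarith

theorem form_vicsekConductance_add_le {H : ℝ} (hH : 0 < H) {a : Fin 5 → Fin 4 → 𝕜}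
    (ha : IsGlued a) :
    form (vicsekConductance H) (fun k => a k.succ k) +
        (6 * ∑ k : Fin 4, ‖defect (a k.succ)‖ ^ 2 +
          ‖3 * defect (a 0) - defect fun k => a k.succ k‖ ^ 2) ≤
      3 * ∑ i, form (vicsekConductance H) (a i) := by
  set u : Fin 4 → 𝕜 := fun k => a k.succ k
  set p : Fin 4 → 𝕜 := fun k => u k - a 0 k
  have harm : ∀ k, 2 * (‖defect (a k.succ)‖ ^ 2 +
      (1 + vicsekConductance H k (k + 2)) * ‖p k‖ ^ 2) ≤ form (vicsekConductance H) (a k.succ) :=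
    fun k => by simpa only [p, ha k] using le_form_vicsekConductance_arm hH (a k.succ) k
  have hdiag₀ := two_mul_norm_add_sub_sq_le (a 0 0 - a 0 2) (p 0) (p 2)
  have hdiag₁ := two_mul_norm_add_sub_sq_le (a 0 1 - a 0 3) (p 1) (p 3)
  have hcross := norm_sub_sq_le_add hH (p 0 + p 2) (p 1 + p 3)
  have hdefect := two_mul_norm_add_sq_add_norm_two_mul_sub_sq (defect (a 0))
    (p 0 + p 2 - (p 1 + p 3))
  rw [show a 0 0 - a 0 2 + (p 0 - p 2) = u 0 - u 2 by ring] at hdiag₀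
  rw [show a 0 1 - a 0 3 + (p 1 - p 3) = u 1 - u 3 by ring] at hdiag₁
  rw [show defect (a 0) + (p 0 + p 2 - (p 1 + p 3)) = defect u by simp only [defect, p]; ring,
    show 2 * defect (a 0) - (p 0 + p 2 - (p 1 + p 3)) = 3 * defect (a 0) - defect u by
      simp only [defect, p]; ring] at hdefect
  have h₀ := mul_le_mul_of_nonneg_left hdiag₀ (add_pos one_pos hH).le
  have h₁ := mul_le_mul_of_nonneg_left hdiag₁ (add_pos one_pos (inv_pos.2 hH)).le
  have harms := Finset.sum_le_sum fun k (_ : k ∈ Finset.univ) => harm k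
  rw [Fin.sum_univ_succ fun i => form (vicsekConductance H) (a i), form_vicsekConductance H u,
    form_vicsekConductance H (a 0)]
  simp only [← Finset.mul_sum, Finset.sum_add_distrib] at harms
  rw [Fin.sum_univ_four (fun k => (1 + vicsekConductance H k (k + 2)) * ‖p k‖ ^ 2)] at harms
  change 2 * (_ + ((1 + H) * ‖p 0‖ ^ 2 + (1 + H⁻¹) * ‖p 1‖ ^ 2 + (1 + H) * ‖p 2‖ ^ 2 +
    (1 + H⁻¹) * ‖p 3‖ ^ 2)) ≤ _ at harms
  linarith

theorem form_vicsekConductance_le {H : ℝ} (hH : 0 < H) {a : Fin 5 → Fin 4 → 𝕜} (ha : IsGlued a) :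
    form (vicsekConductance H) (fun k => a k.succ k) ≤
      3 * ∑ i, form (vicsekConductance H) (a i) :=
  (le_add_of_nonneg_right (by positivity)).trans (form_vicsekConductance_add_le hH ha)

theorem sum_norm_defect_sq_le {H : ℝ} (hH : 0 < H) {a : Fin 5 → Fin 4 → 𝕜} (ha : IsGlued a) :
    9 * ∑ i, ‖defect (a i)‖ ^ 2 ≤ 2 * ‖defect fun k => a k.succ k‖ ^ 2 +
      2 * (3 * ∑ i, form (vicsekConductance H) (a i) -
        form (vicsekConductance H) fun k => a k.succ k) := by
  set w := defect fun k => a k.succ k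
  have hcentre : 9 * ‖defect (a 0)‖ ^ 2 ≤ 2 * ‖w‖ ^ 2 + 2 * ‖3 * defect (a 0) - w‖ ^ 2 := by
    have h := norm_sub_sq_le_add one_pos w (w - 3 * defect (a 0))
    rw [sub_sub_cancel, norm_mul, RCLike.norm_ofNat, norm_sub_rev w] at h
    linarith
  have harms : 0 ≤ ∑ k : Fin 4, ‖defect (a k.succ)‖ ^ 2 := by positivity
  rw [Fin.sum_univ_succ]
  linarith [form_vicsekConductance_add_le hH ha]

end Forms

section Eigenform

theorem vicsekConductance_comm (H : ℝ) (i j : Fin 4) :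
    vicsekConductance H i j = vicsekConductance H j i := by
  fin_cases i <;> fin_cases j <;> rfl

theorem vicsekConductance_pos {H : ℝ} (hH : 0 < H) {i j : Fin 4} (hij : i ≠ j) :
    0 < vicsekConductance H i j := by
  fin_cases i <;> fin_cases j <;> simp [vicsekConductance, hH] at hij ⊢

/-- The value at `w₀(p_k)` of the energy minimizing extension of `u` to the cells of level one. -/
def harmonicInner (H : ℝ) (u : Fin 4 → ℝ) : Fin 4 → ℝ :=
  ![(2 * u 0 + u 2 - defect u / (1 + H)) / 3, (2 * u 1 + u 3 + H * defect u / (1 + H)) / 3,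
    (2 * u 2 + u 0 - defect u / (1 + H)) / 3, (2 * u 3 + u 1 + H * defect u / (1 + H)) / 3]

/-- The function on a rhombus with value `x` at the vertex `k`, `y` at the opposite vertex, and the
mean value at the two other vertices. -/
def interpolate (k : Fin 4) (x y : ℝ) (j : Fin 4) : ℝ :=
  if j = k then x else if j = k + 2 then y else (x + y) / 2

theorem form_interpolate (H x y : ℝ) (k : Fin 4) :
    form (vicsekConductance H) (interpolate k x y) =
      2 * (1 + vicsekConductance H k (k + 2)) * (x - y) ^ 2 := by
  rw [form_vicsekConductance]
  fin_cases k <;> simp [defect, interpolate, vicsekConductance] <;> ring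

theorem form_harmonicInner_add {H : ℝ} (hH : 0 < H) (u : Fin 4 → ℝ) :
    form (vicsekConductance H) (harmonicInner H u) +
        ∑ k, form (vicsekConductance H) (interpolate k (u k) (harmonicInner H u k)) =
      1 / 3 * form (vicsekConductance H) u := by
  have hdiag : ∀ k, 1 + vicsekConductance H k (k + 2) = ![1 + H, 1 + H⁻¹, 1 + H, 1 + H⁻¹] k :=
    fun k => by fin_cases k <;> rfl
  simp only [form_interpolate, hdiag]
  simp only [form_vicsekConductance, Fin.sum_univ_four, Real.norm_eq_abs, sq_abs, harmonicInner,
    defect, Matrix.cons_val]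
  field_simp
  ring

theorem exists_extension_cellSum_eq {ϑ : ℝ} (hϑ : ϑ ∈ Set.Ioo 0 (Real.pi / 2)) {H : ℝ} (hH : 0 < H)
    (u : Fin 4 → ℝ) : ∃ g : Plane → ℝ, (∀ k, g (vertex ϑ k) = u k) ∧
      cellSum ϑ (form (vicsekConductance H)) 1 g = 1 / 3 * form (vicsekConductance H) u := by
  obtain ⟨g, hg⟩ := IsGlued.exists_extension hϑ (a := Fin.cons (harmonicInner H u) fun k =>
    interpolate k (u k) (harmonicInner H u k)) fun k => by simp [interpolate]
  refine ⟨g, fun k => ?_, ?_⟩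
  · rw [← sim_succ_vertex, hg]
    simp [interpolate]
  · simp only [cellSum_one, hg, Fin.sum_univ_succ (n := 4), Fin.cons_zero, Fin.cons_succ]
    exact form_harmonicInner_add hH u

theorem isEigenform_vicsekConductance {ϑ : ℝ} (hϑ : ϑ ∈ Set.Ioo 0 (Real.pi / 2)) {H : ℝ}
    (hH : 0 < H) : IsEigenform ϑ (vicsekConductance H) (1 / 3) := by
  refine ⟨fun i j hij => ⟨vicsekConductance_comm H i j, vicsekConductance_pos hH hij⟩,
    by norm_num, fun u => ⟨?_, fun t ht => ?_⟩⟩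
  · rintro _ ⟨g, hg, rfl⟩
    have h := form_vicsekConductance_le hH (isGlued_comp_sim ϑ g)
    simp only [sim_succ_vertex, hg] at h
    change _ ≤ cellSum ϑ (form (vicsekConductance H)) 1 g
    rw [cellSum_one]
    linarith
  · obtain ⟨g, hg, hsum⟩ := exists_extension_cellSum_eq hϑ hH u
    exact ht ⟨g, hg, hsum.symm⟩

end Eigenform

section AngleParameter

theorem paramH_eq {ϑ : ℝ} (hϑ : ϑ ∈ Set.Ioo 0 (Real.pi / 2)) :
    paramH ϑ = (2 + (Real.cos ϑ)⁻¹) / (2 + (Real.sin ϑ)⁻¹) := by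
  have hs := sin_pos_of_mem_Ioo hϑ
  have hc := cos_pos_of_mem_Ioo hϑ
  have htan : √(1 + Real.tan ϑ ^ 2) = (Real.cos ϑ)⁻¹ := by
    rw [← Real.inv_sqrt_one_add_tan_sq hc, inv_inv]
  have hcot : √(1 + Real.cot ϑ ^ 2) = (Real.sin ϑ)⁻¹ := by
    rw [← Real.cos_pi_div_two_sub, ← Real.inv_sqrt_one_add_tan_sq, inv_inv,
      Real.tan_pi_div_two_sub, Real.tan_inv_eq_cot]
    rwa [Real.cos_pi_div_two_sub]
  rw [paramH, htan, hcot]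

theorem paramH_pos (ϑ : ℝ) : 0 < paramH ϑ := by
  unfold paramH
  positivity

theorem strictMonoOn_paramH : StrictMonoOn paramH (Set.Ioo 0 (Real.pi / 2)) := by
  intro ϑ₁ h₁ ϑ₂ h₂ hlt
  have hs₁ := sin_pos_of_mem_Ioo h₁
  have hc₂ := cos_pos_of_mem_Ioo h₂
  have hsin : Real.sin ϑ₁ < Real.sin ϑ₂ :=
    Real.sin_lt_sin_of_lt_of_le_pi_div_two (by linarith [h₁.1, Real.pi_pos]) h₂.2.le hlt
  have hcos : Real.cos ϑ₂ < Real.cos ϑ₁ :=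
    Real.cos_lt_cos_of_nonneg_of_le_pi_div_two h₁.1.le h₂.2.le hlt
  have : 0 < Real.cos ϑ₁ := hc₂.trans hcos
  have : 0 < Real.sin ϑ₂ := hs₁.trans hsin
  rw [paramH_eq h₁, paramH_eq h₂]
  gcongr

theorem exists_paramH_eq {H : ℝ} (hH : 0 < H) :
    ∃ ϑ ∈ Set.Ioo 0 (Real.pi / 2), paramH ϑ = H := by
  -- `F ϑ` is the difference of the two sides of `paramH ϑ = H` after clearing denominators.
  let F : ℝ → ℝ := fun ϑ =>
    Real.sin ϑ * (2 * Real.cos ϑ + 1) - H * (Real.cos ϑ * (2 * Real.sin ϑ + 1))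
  have hF : Continuous F := by fun_prop
  have h₀ : (0 : ℝ) ∈ Set.Ioo (F 0) (F (Real.pi / 2)) := by simp [F, hH]
  obtain ⟨ϑ, hϑ, hzero⟩ := intermediate_value_Ioo (by positivity) hF.continuousOn h₀
  have hs := sin_pos_of_mem_Ioo hϑ
  have hc := cos_pos_of_mem_Ioo hϑ
  refine ⟨ϑ, hϑ, ?_⟩
  simp only [F] at hzero
  rw [paramH_eq hϑ]
  field_simp
  linarith

theorem existsUnique_paramH_eq {H : ℝ} (hH : 0 < H) :
    ∃! ϑ : ℝ, ϑ ∈ Set.Ioo (0 : ℝ) (Real.pi / 2) ∧ paramH ϑ = H := by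
  obtain ⟨ϑ, hϑ, rfl⟩ := exists_paramH_eq hH
  exact ⟨ϑ, ⟨hϑ, rfl⟩, fun ϑ' h => strictMonoOn_paramH.injOn h.1 hϑ h.2⟩

end AngleParameter

section RenormalizedSums

variable {α : Type*} {𝕜 : Type} [RCLike 𝕜]

/-- The renormalized sums `3^n ∑_{|σ| = n} q[f ∘ w_σ]`. -/
def scaledSum (ϑ : ℝ) (q : (Fin 4 → α) → ℝ) (f : Plane → α) (n : ℕ) : ℝ :=
  3 ^ n * cellSum ϑ q n f

theorem inv_pow_mul_formSum (ϑ : ℝ) (c : Fin 4 → Fin 4 → ℝ) (n : ℕ) (f : Plane → 𝕜) :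
    ((1 / 3 : ℝ) ^ n)⁻¹ * formSum ϑ c n f = scaledSum ϑ (form c) f n := by
  rw [one_div, inv_pow, inv_inv]
  rfl

theorem scaledSum_nonneg {ϑ : ℝ} {q : (Fin 4 → α) → ℝ} (hq : ∀ u, 0 ≤ q u) (f : Plane → α)
    (n : ℕ) : 0 ≤ scaledSum ϑ q f n :=
  mul_nonneg (by positivity) (cellSum_nonneg hq n f)

theorem scaledSum_linearCombination (ϑ a b : ℝ) (q₁ q₂ : (Fin 4 → α) → ℝ) (f : Plane → α) (n : ℕ) :
    scaledSum ϑ (fun u => a * q₁ u + b * q₂ u) f n =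
      a * scaledSum ϑ q₁ f n + b * scaledSum ϑ q₂ f n := by
  simp only [scaledSum, cellSum, Finset.sum_add_distrib, ← Finset.mul_sum]
  ring

theorem scaledSum_le_scaledSum_succ {ϑ : ℝ} {q₁ q₂ : (Fin 4 → α) → ℝ}
    (h : ∀ a : Fin 5 → Fin 4 → α, IsGlued a → q₁ (fun k => a k.succ k) ≤ 3 * ∑ i, q₂ (a i))
    (f : Plane → α) (n : ℕ) : scaledSum ϑ q₁ f n ≤ scaledSum ϑ q₂ f (n + 1) := by
  have hcell := cellSum_le_cellSum_succ (ϑ := ϑ) (q₂ := fun u => 3 * q₂ u)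
    (fun a ha => by simpa only [Finset.mul_sum] using h a ha) n f
  rw [scaledSum, scaledSum, pow_succ, mul_assoc]
  gcongr
  simpa only [cellSum, Finset.mul_sum] using hcell

theorem monotone_scaledSum_form {H : ℝ} (hH : 0 < H) (ϑ : ℝ) (f : Plane → 𝕜) :
    Monotone (scaledSum ϑ (form (vicsekConductance H)) f) :=
  monotone_nat_of_le_succ <|
    scaledSum_le_scaledSum_succ (fun _ ha => form_vicsekConductance_le hH ha) f

theorem tendsto_limitEnergy {H : ℝ} (hH : 0 < H) (ϑ : ℝ) (f : Plane → ℂ) :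
    Tendsto (fun n : ℕ => ENNReal.ofReal
        (((1 / 3 : ℝ) ^ n)⁻¹ * formSum ϑ (vicsekConductance H) n f)) atTop
      (𝓝 (limitEnergy ϑ (vicsekConductance H) (1 / 3) f)) := by
  have hlim := tendsto_atTop_iSup (ENNReal.ofReal_mono.comp (monotone_scaledSum_form hH ϑ f))
  simp only [limitEnergy, inv_pow_mul_formSum]
  rwa [← hlim.limsup_eq] at hlim

theorem tendsto_scaledSum_form {H : ℝ} (hH : 0 < H) {ϑ : ℝ} {f : Plane → ℂ}
    (hf : limitEnergy ϑ (vicsekConductance H) (1 / 3) f < ⊤) :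
    Tendsto (scaledSum ϑ (form (vicsekConductance H)) f) atTop
      (𝓝 (limitEnergy ϑ (vicsekConductance H) (1 / 3) f).toReal) := by
  refine ((ENNReal.tendsto_toReal hf.ne).comp (tendsto_limitEnergy hH ϑ f)).congr fun n => ?_
  rw [Function.comp_apply, inv_pow_mul_formSum,
    ENNReal.toReal_ofReal (scaledSum_nonneg (form_vicsekConductance_nonneg hH) f n)]

theorem tendsto_zero_of_succ_le_mul_add_sub {Y E : ℕ → ℝ} {r : ℝ} (hr : r < 1) (hY : ∀ n, 0 ≤ Y n)
    (hE : BddAbove (Set.range E)) (h : ∀ n, Y (n + 1) ≤ r * Y n + (E (n + 1) - E n)) :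
    Tendsto Y atTop (𝓝 0) := by
  obtain ⟨M, hM⟩ := hE
  have hsum : ∀ n, (1 - r) * ∑ i ∈ Finset.range n, Y i ≤ Y 0 - Y n + (E n - E 0) := fun n => by
    induction n with
    | zero => simp
    | succ n ih =>
      rw [Finset.sum_range_succ]
      linarith [h n]
  refine (summable_of_sum_range_le (c := (Y 0 + (M - E 0)) / (1 - r)) hY fun n => ?_)
    |>.tendsto_atTop_zero
  rw [le_div_iff₀' (sub_pos.2 hr)]
  linarith [hsum n, hY n, hM ⟨n, rfl⟩]

theorem tendsto_scaledSum_norm_defect_sq {H : ℝ} (hH : 0 < H) {ϑ : ℝ} {f : Plane → 𝕜}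
    (hf : BddAbove (Set.range (scaledSum ϑ (form (vicsekConductance H)) f))) :
    Tendsto (scaledSum ϑ (fun u => ‖defect u‖ ^ 2) f) atTop (𝓝 0) := by
  refine tendsto_zero_of_succ_le_mul_add_sub (r := 2 / 3)
    (E := fun n => 2 / 3 * scaledSum ϑ (form (vicsekConductance H)) f n) (by norm_num)
    (scaledSum_nonneg (fun u => sq_nonneg ‖defect u‖) f) ?_ fun n => ?_
  · obtain ⟨M, hM⟩ := hf
    exact ⟨2 / 3 * M, Set.forall_mem_range.2 fun n =>
      mul_le_mul_of_nonneg_left (hM ⟨n, rfl⟩) (by norm_num)⟩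
  · have hstep := scaledSum_le_scaledSum_succ (ϑ := ϑ)
      (q₁ := fun u : Fin 4 → 𝕜 => 2 * form (vicsekConductance H) u + -2 * ‖defect u‖ ^ 2)
      (q₂ := fun u => 2 * form (vicsekConductance H) u + -3 * ‖defect u‖ ^ 2)
      (fun a ha => by
        rw [Finset.sum_add_distrib, ← Finset.mul_sum, ← Finset.mul_sum]
        linarith [sum_norm_defect_sq_le hH ha]) f n
    rw [scaledSum_linearCombination, scaledSum_linearCombination] at hstep
    linarith

end RenormalizedSums

section LengthConductance

variable {ϑ : ℝ}

/-- The conductances `ℓ(e)⁻¹`. -/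
def lengthConductance (ϑ : ℝ) (i j : Fin 4) : ℝ := (dist (vertex ϑ i) (vertex ϑ j))⁻¹

theorem dist_vertex_add_one (ϑ : ℝ) (i : Fin 4) : dist (vertex ϑ i) (vertex ϑ (i + 1)) = 1 := by
  rw [EuclideanSpace.dist_eq, Real.sqrt_eq_one]
  fin_cases i <;> simp [vertex, Fin.sum_univ_two, Real.dist_eq]

theorem dist_vertex_zero_two (hϑ : ϑ ∈ Set.Ioo 0 (Real.pi / 2)) :
    dist (vertex ϑ 0) (vertex ϑ 2) = 2 * Real.cos ϑ := by
  have hc := cos_pos_of_mem_Ioo hϑ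
  rw [EuclideanSpace.dist_eq, Real.sqrt_eq_iff_mul_self_eq_of_pos (by positivity)]
  simp [vertex, Fin.sum_univ_two, Real.dist_eq]
  ring

theorem dist_vertex_one_three (hϑ : ϑ ∈ Set.Ioo 0 (Real.pi / 2)) :
    dist (vertex ϑ 1) (vertex ϑ 3) = 2 * Real.sin ϑ := by
  have hs := sin_pos_of_mem_Ioo hϑ
  rw [EuclideanSpace.dist_eq, Real.sqrt_eq_iff_mul_self_eq_of_pos (by positivity)]
  simp [vertex, Fin.sum_univ_two, Real.dist_eq]
  ring

/-- The factor `κ` for which the form with conductances `ℓ(e)⁻¹` differs from `κ` times the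
eigenform only in the defect: it solves `1 + ℓ₀₂⁻¹ = κ (1 + H)` and `1 + ℓ₁₃⁻¹ = κ (1 + H⁻¹)`
with `H = paramH ϑ`. -/
def energyRatio (ϑ : ℝ) : ℝ :=
  (2 + (Real.cos ϑ)⁻¹) * (2 + (Real.sin ϑ)⁻¹) / (2 * (4 + (Real.cos ϑ)⁻¹ + (Real.sin ϑ)⁻¹))

theorem energyRatio_pos (hϑ : ϑ ∈ Set.Ioo 0 (Real.pi / 2)) : 0 < energyRatio ϑ := by
  have hs := sin_pos_of_mem_Ioo hϑ
  have hc := cos_pos_of_mem_Ioo hϑ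
  unfold energyRatio
  positivity

theorem form_lengthConductance {𝕜 : Type} [RCLike 𝕜] (hϑ : ϑ ∈ Set.Ioo 0 (Real.pi / 2))
    (u : Fin 4 → 𝕜) :
    form (lengthConductance ϑ) u = energyRatio ϑ * form (vicsekConductance (paramH ϑ)) u +
      2 * (1 - energyRatio ϑ) * ‖defect u‖ ^ 2 := by
  have hs := sin_pos_of_mem_Ioo hϑ
  have hc := cos_pos_of_mem_Ioo hϑ
  have hside : ∀ i : Fin 4, lengthConductance ϑ i (i + 1) = 1 := fun i => by
    rw [lengthConductance, dist_vertex_add_one, inv_one]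
  have h₀₂ : 1 + lengthConductance ϑ 0 2 = energyRatio ϑ * (1 + paramH ϑ) := by
    rw [lengthConductance, dist_vertex_zero_two hϑ, energyRatio, paramH_eq hϑ]
    field_simp
    ring
  have h₁₃ : 1 + lengthConductance ϑ 1 3 = energyRatio ϑ * (1 + (paramH ϑ)⁻¹) := by
    rw [lengthConductance, dist_vertex_one_three hϑ, energyRatio, paramH_eq hϑ]
    field_simp
    ring
  rw [form_eq_of_unit_sides (fun i j => congrArg _ (dist_comm _ _)) (hside 0) (hside 1) (hside 2)
    (hside 3), form_vicsekConductance, h₀₂, h₁₃]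
  ring

theorem tendsto_scaledSum_form_lengthConductance (hϑ : ϑ ∈ Set.Ioo 0 (Real.pi / 2))
    {f : Plane → ℂ} (hf : limitEnergy ϑ (vicsekConductance (paramH ϑ)) (1 / 3) f < ⊤) :
    Tendsto (scaledSum ϑ (form (lengthConductance ϑ)) f) atTop
      (𝓝 (energyRatio ϑ * (limitEnergy ϑ (vicsekConductance (paramH ϑ)) (1 / 3) f).toReal)) := by
  have henergy := tendsto_scaledSum_form (paramH_pos ϑ) hf
  have hdefect := tendsto_scaledSum_norm_defect_sq (paramH_pos ϑ) henergy.bddAbove_range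
  have hlim := (henergy.const_mul (energyRatio ϑ)).add
    (hdefect.const_mul (2 * (1 - energyRatio ϑ)))
  rw [mul_zero, add_zero] at hlim
  refine hlim.congr fun n => ?_
  rw [funext (form_lengthConductance hϑ), scaledSum_linearCombination]

end LengthConductance

section AbelianTheorem

theorem summable_mul_pow_of_tendsto {τ : ℕ → ℝ} {l r : ℝ} (hτ : Tendsto τ atTop (𝓝 l))
    (hr₀ : 0 ≤ r) (hr₁ : r < 1) : Summable fun n => τ n * r ^ n := by
  obtain ⟨C, hC⟩ := hτ.norm.bddAbove_range
  refine Summable.of_norm_bounded ((summable_geometric_of_lt_one hr₀ hr₁).mul_left C) fun n => ?_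
  rw [norm_mul, norm_pow, Real.norm_of_nonneg hr₀]
  gcongr
  exact hC ⟨n, rfl⟩

theorem one_sub_mul_tsum_mul_pow {τ : ℕ → ℝ} {r : ℝ} (h : Summable fun n => τ n * r ^ n) :
    (1 - r) * ∑' n, τ n * r ^ n = τ 0 + ∑' n, (τ (n + 1) - τ n) * r ^ (n + 1) := by
  have hsucc : Summable fun n => τ (n + 1) * r ^ (n + 1) := (summable_nat_add_iff 1).2 h
  have hdiff : ∑' n, (τ (n + 1) - τ n) * r ^ (n + 1) =
      ∑' n, τ (n + 1) * r ^ (n + 1) - r * ∑' n, τ n * r ^ n := by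
    rw [← tsum_mul_left, ← hsucc.tsum_sub (h.mul_left r)]
    congr with n
    ring
  have hzero := h.tsum_eq_zero_add
  rw [pow_zero, mul_one] at hzero
  linarith

theorem tendsto_one_sub_mul_tsum_mul_pow {τ : ℕ → ℝ} {l : ℝ} (hτ : Tendsto τ atTop (𝓝 l)) :
    Tendsto (fun r : ℝ => (1 - r) * ∑' n, τ n * r ^ n) (𝓝[<] 1) (𝓝 l) := by
  have hpartial : Tendsto (fun n => ∑ i ∈ Finset.range n, (τ (i + 1) - τ i)) atTop
      (𝓝 (l - τ 0)) := by
    simpa only [Finset.sum_range_sub] using hτ.sub_const (τ 0)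
  have hid : Tendsto (fun r : ℝ => r) (𝓝[<] 1) (𝓝 1) :=
    tendsto_nhdsWithin_of_tendsto_nhds tendsto_id
  have hlim := ((hid.mul (Real.tendsto_tsum_powerSeries_nhdsWithin_lt hpartial)).const_add (τ 0))
  rw [one_mul, add_sub_cancel] at hlim
  refine hlim.congr' ?_
  filter_upwards [Ioo_mem_nhdsLT (zero_lt_one' ℝ)] with r hr
  rw [one_sub_mul_tsum_mul_pow (summable_mul_pow_of_tendsto hτ hr.1.le hr.2), ← tsum_mul_left]
  simp only [pow_succ']
  congr with n
  ring

theorem tendsto_sub_one_div_one_sub_rpow {b : ℝ} (hb : 1 < b) :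
    Tendsto (fun s : ℝ => (s - 1) / (1 - b ^ (1 - s))) (𝓝[>] 1) (𝓝 (Real.log b)⁻¹) := by
  have hlog := Real.log_pos hb
  have hderiv : HasDerivAt (fun s : ℝ => -b ^ (1 - s)) (Real.log b) 1 := by
    simpa using (((hasDerivAt_id (1 : ℝ)).const_sub 1).const_rpow (zero_lt_one.trans hb)).fun_neg
  have hslope := ((hasDerivAt_iff_tendsto_slope.1 hderiv).mono_left
    (nhdsWithin_mono 1 fun s (hs : 1 < s) => hs.ne')).inv₀ hlog.ne'
  refine hslope.congr fun s => ?_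
  rw [slope_def_field, inv_div, sub_self, Real.rpow_zero, neg_sub_neg]

theorem tendsto_sub_one_mul_tsum_mul_rpow_pow {τ : ℕ → ℝ} {l b : ℝ} (hτ : Tendsto τ atTop (𝓝 l))
    (hb : 1 < b) :
    Tendsto (fun s : ℝ => (s - 1) * ∑' n, τ n * (b ^ (1 - s)) ^ n) (𝓝[>] 1)
      (𝓝 (l / Real.log b)) := by
  have hlt : ∀ᶠ s in 𝓝[>] (1 : ℝ), b ^ (1 - s) < 1 := by
    filter_upwards [self_mem_nhdsWithin] with s hs
    exact Real.rpow_lt_one_of_one_lt_of_neg hb (sub_neg.2 hs)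
  have hcont : ContinuousAt (fun s : ℝ => b ^ (1 - s)) 1 :=
    (Real.continuousAt_const_rpow (zero_lt_one.trans hb).ne').comp (by fun_prop)
  have hbase : Tendsto (fun s : ℝ => b ^ (1 - s)) (𝓝[>] 1) (𝓝[<] 1) := by
    refine tendsto_nhdsWithin_iff.2 ⟨?_, hlt⟩
    simpa using hcont.tendsto.mono_left nhdsWithin_le_nhds
  have hlim := (tendsto_sub_one_div_one_sub_rpow hb).mul
    ((tendsto_one_sub_mul_tsum_mul_pow hτ).comp hbase)
  rw [inv_mul_eq_div] at hlim
  refine hlim.congr' ?_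
  filter_upwards [hlt] with s hs
  rw [Function.comp_apply, ← mul_assoc, div_mul_cancel₀ _ (sub_pos.2 hs).ne']

theorem summable_rpow_mul {ι : Type*} {d g : ι → ℝ} {M t : ℝ} (hd : ∀ i, 0 ≤ d i)
    (hdM : ∀ i, d i ≤ M) (ht : 0 ≤ t) (hg : ∀ i, 0 ≤ g i) (hsum : Summable g) :
    Summable fun i => d i ^ t * g i :=
  (hsum.mul_left (M ^ t)).of_nonneg_of_le
    (fun i => mul_nonneg (Real.rpow_nonneg (hd i) t) (hg i))
    fun i => mul_le_mul_of_nonneg_right (Real.rpow_le_rpow (hd i) (hdM i) ht) (hg i)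

theorem tendsto_sub_one_mul_tsum_rpow_mul {ι : Type*} {d : ι → ℝ} {G : ℝ → ι → ℝ} {m M l : ℝ}
    (hm : 0 < m) (hM : 0 < M) (hmd : ∀ i, m ≤ d i) (hdM : ∀ i, d i ≤ M) (hG : ∀ s i, 0 ≤ G s i)
    (hsum : ∀ s, 1 < s → Summable (G s))
    (hl : Tendsto (fun s : ℝ => (s - 1) * ∑' i, G s i) (𝓝[>] 1) (𝓝 l)) :
    Tendsto (fun s : ℝ => (s - 1) * ∑' i, d i ^ (s - 1) * G s i) (𝓝[>] 1) (𝓝 l) := by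
  have hfactor : ∀ k : ℝ, 0 < k →
      Tendsto (fun s : ℝ => (s - 1) * ∑' i, k ^ (s - 1) * G s i) (𝓝[>] 1) (𝓝 l) := fun k hk => by
    have hcont : ContinuousAt (fun s : ℝ => k ^ (s - 1)) 1 :=
      (Real.continuousAt_const_rpow hk.ne').comp (by fun_prop)
    have hlim := (hcont.tendsto.mono_left nhdsWithin_le_nhds).mul hl
    rw [sub_self, Real.rpow_zero, one_mul] at hlim
    simpa only [tsum_mul_left, mul_left_comm] using hlim
  have hd : ∀ i, 0 ≤ d i := fun i => hm.le.trans (hmd i)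
  refine tendsto_of_tendsto_of_tendsto_of_le_of_le' (hfactor m hm) (hfactor M hM) ?_ ?_
  all_goals
    filter_upwards [self_mem_nhdsWithin] with s (hs : 1 < s)
    have hpos := sub_pos.2 hs
    have hweighted := summable_rpow_mul hd hdM hpos.le (hG s) (hsum s hs)
    refine mul_le_mul_of_nonneg_left ?_ hpos.le
  · exact ((hsum s hs).mul_left _).tsum_le_tsum (fun i => mul_le_mul_of_nonneg_right
      (Real.rpow_le_rpow hm.le (hmd i) hpos.le) (hG s i)) hweighted
  · exact hweighted.tsum_le_tsum (fun i => mul_le_mul_of_nonneg_right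
      (Real.rpow_le_rpow (hd i) (hdM i) hpos.le) (hG s i)) ((hsum s hs).mul_left _)

end AbelianTheorem

section ZetaFunction

theorem hasSum_edge_of_nonneg {F : Edge → ℝ} (hF : ∀ e, 0 ≤ F e)
    (hs : Summable fun n => ∑ σ : Word n, ∑ e : Edge₀, F (⟨n, σ⟩, e)) :
    HasSum F (∑' n, ∑ σ : Word n, ∑ e : Edge₀, F (⟨n, σ⟩, e)) := by
  have hword : Summable fun w : Σ n, Word n => ∑ e : Edge₀, F (w, e) := by
    rw [summable_sigma_of_nonneg fun w => Finset.sum_nonneg fun e _ => hF _]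
    exact ⟨fun n => (hasSum_fintype _).summable, by simpa only [tsum_fintype] using hs⟩
  have hedge : Summable F := by
    rw [summable_prod_of_nonneg hF]
    exact ⟨fun w => (hasSum_fintype _).summable, by simpa only [tsum_fintype] using hword⟩
  rw [hedge.hasSum_iff, hedge.tsum_prod]
  simp only [tsum_fintype]
  rw [hword.tsum_sigma]
  simp only [tsum_fintype]

theorem vertex_injective {ϑ : ℝ} (hϑ : ϑ ∈ Set.Ioo 0 (Real.pi / 2)) :
    Function.Injective (vertex ϑ) := by
  have hcoord : Function.Injective fun k : Fin 4 => fixedCoord k.succ := by decide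
  intro i j hij
  rw [← fixedPt_succ, ← fixedPt_succ, ← diagPt_fixedCoord, ← diagPt_fixedCoord] at hij
  exact hcoord (diagPt_injective hϑ hij)

theorem exists_pos_le_dist_vertex {ϑ : ℝ} (hϑ : ϑ ∈ Set.Ioo 0 (Real.pi / 2)) :
    ∃ m : ℝ, 0 < m ∧ ∀ e : Edge₀, m ≤ dist (vertex ϑ e.1.1) (vertex ϑ e.1.2) := by
  have : Nonempty Edge₀ := ⟨⟨(0, 1), by decide⟩⟩
  obtain ⟨e₀, he₀⟩ := Finite.exists_min fun e : Edge₀ => dist (vertex ϑ e.1.1) (vertex ϑ e.1.2)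
  exact ⟨_, dist_pos.2 ((vertex_injective hϑ).ne e₀.2), he₀⟩

/-- The energy `ℓ(e)⁻¹ |f(e⁺) - f(e⁻)|²` of `f` along the edge `e`. -/
def edgeEnergy (ϑ : ℝ) (f : Plane → ℂ) (e : Edge) : ℝ :=
  (e.length ϑ)⁻¹ * ‖f (e.src ϑ) - f (e.rev.src ϑ)‖ ^ 2

theorem edgeEnergy_nonneg (ϑ : ℝ) (f : Plane → ℂ) (e : Edge) : 0 ≤ edgeEnergy ϑ f e :=
  mul_nonneg (inv_nonneg.2 (e.length_nonneg ϑ)) (sq_nonneg _)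

theorem sum_edgeEnergy (ϑ : ℝ) (f : Plane → ℂ) (n : ℕ) :
    ∑ σ : Word n, ∑ e : Edge₀, edgeEnergy ϑ f (⟨n, σ⟩, e) =
      scaledSum ϑ (form (lengthConductance ϑ)) f n := by
  simp only [edgeEnergy, Edge.length, mul_inv, mul_assoc, one_div, inv_pow, inv_inv,
    ← Finset.mul_sum]
  rfl

theorem length_rpow_mul_norm_diffQuot_sq (ϑ : ℝ) (f : Plane → ℂ) (s : ℝ) (e : Edge) :
    e.length ϑ ^ s * ‖diffQuot ϑ f e‖ ^ 2 = dist (vertex ϑ e.2.1.1) (vertex ϑ e.2.1.2) ^ (s - 1) *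
      (edgeEnergy ϑ f e * ((3 : ℝ) ^ (1 - s)) ^ e.1.1) := by
  have hscale : ((1 / 3 : ℝ) ^ e.1.1) ^ (s - 1) = ((3 : ℝ) ^ (1 - s)) ^ e.1.1 := by
    rw [← neg_sub s, Real.rpow_neg_eq_inv_rpow, one_div, Real.rpow_pow_comm (by positivity)]
  have hlength : e.length ϑ ^ (s - 1) =
      ((3 : ℝ) ^ (1 - s)) ^ e.1.1 * dist (vertex ϑ e.2.1.1) (vertex ϑ e.2.1.2) ^ (s - 1) := by
    rw [Edge.length, Real.mul_rpow (by positivity) dist_nonneg, hscale]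
  have hentry : e.length ϑ ^ s * ‖diffQuot ϑ f e‖ ^ 2 =
      e.length ϑ ^ (s - 1) * edgeEnergy ϑ f e := by
    obtain hL | hL := eq_or_ne (e.length ϑ) 0
    · simp [diffQuot, edgeEnergy, hL]
    · rw [Real.rpow_sub_one hL, diffQuot, edgeEnergy, norm_mul, Complex.norm_real, norm_sub_rev,
        norm_inv, Real.norm_of_nonneg (e.length_nonneg ϑ)]
      field_simp
  rw [hentry, hlength]
  ring

theorem hasSum_edgeEnergy_mul_pow {ϑ : ℝ} {f : Plane → ℂ} {l r : ℝ}
    (hf : Tendsto (scaledSum ϑ (form (lengthConductance ϑ)) f) atTop (𝓝 l)) (hr₀ : 0 ≤ r)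
    (hr₁ : r < 1) : HasSum (fun e : Edge => edgeEnergy ϑ f e * r ^ e.1.1)
      (∑' n, scaledSum ϑ (form (lengthConductance ϑ)) f n * r ^ n) := by
  have hlevel : ∀ n, ∑ σ : Word n, ∑ e : Edge₀, edgeEnergy ϑ f (⟨n, σ⟩, e) * r ^ n =
      scaledSum ϑ (form (lengthConductance ϑ)) f n * r ^ n := fun n => by
    simp only [← Finset.sum_mul, sum_edgeEnergy]
  have hsum := hasSum_edge_of_nonneg (F := fun e => edgeEnergy ϑ f e * r ^ e.1.1)
    (fun e => mul_nonneg (edgeEnergy_nonneg ϑ f e) (by positivity))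
  simp only [hlevel] at hsum
  exact hsum (summable_mul_pow_of_tendsto hf hr₀ hr₁)

theorem exists_hasTrace_zetaOperator {ϑ : ℝ} (hϑ : ϑ ∈ Set.Ioo 0 (Real.pi / 2)) {f : Plane → ℂ}
    {l : ℝ} (hf : Tendsto (scaledSum ϑ (form (lengthConductance ϑ)) f) atTop (𝓝 l)) :
    ∃ Z : ℝ → ℝ, (∀ s : ℝ, 1 < s → HasTrace (zetaOperator ϑ f s) (Z s)) ∧
      Tendsto (fun s : ℝ => (s - 1) * Z s) (𝓝[>] 1) (𝓝 (l / Real.log 3)) := by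
  obtain ⟨m, hm, hmd⟩ := exists_pos_le_dist_vertex hϑ
  set d : Edge → ℝ := fun e => dist (vertex ϑ e.2.1.1) (vertex ϑ e.2.1.2)
  set G : ℝ → Edge → ℝ := fun s e => edgeEnergy ϑ f e * ((3 : ℝ) ^ (1 - s)) ^ e.1.1
  have hG : ∀ s e, 0 ≤ G s e := fun s e => mul_nonneg (edgeEnergy_nonneg ϑ f e) (by positivity)
  have hsum : ∀ s, 1 < s → HasSum (G s)
      (∑' n, scaledSum ϑ (form (lengthConductance ϑ)) f n * ((3 : ℝ) ^ (1 - s)) ^ n) :=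
    fun s hs => hasSum_edgeEnergy_mul_pow hf (by positivity)
      (Real.rpow_lt_one_of_one_lt_of_neg (by norm_num) (sub_neg.2 hs))
  refine ⟨fun s => ∑' e, d e ^ (s - 1) * G s e, fun s hs => ?_, ?_⟩
  · have hentries := length_rpow_mul_norm_diffQuot_sq ϑ f s
    simp only [d, G, ← hentries]
    refine hasTrace_zetaOperator (zero_lt_one.trans hs).le ?_
    simp only [hentries]
    exact summable_rpow_mul (fun e => dist_nonneg) (fun e => dist_vertex_le _ _ _)
      (sub_pos.2 hs).le (hG s) (hsum s hs).summable
  · refine tendsto_sub_one_mul_tsum_rpow_mul hm two_pos (fun e => hmd e.2)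
      (fun e => dist_vertex_le _ _ _) hG (fun s hs => (hsum s hs).summable) ?_
    refine (tendsto_sub_one_mul_tsum_mul_rpow_pow hf (b := 3) (by norm_num)).congr' ?_
    filter_upwards [self_mem_nhdsWithin] with s hs
    rw [(hsum s hs).tsum_eq]

end ZetaFunction

end RhombicVicsek

end

open RhombicVicsek in
theorem theorem3p3_general :
    (∀ ϑ ∈ Set.Ioo (0 : ℝ) (Real.pi / 2),
      deform ϑ '' fractal (Real.pi / 4) = fractal ϑ ∧
      IsEigenform (Real.pi / 4) (vicsekConductance (paramH ϑ)) (1 / 3) ∧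
      (∀ g : Plane → ℂ,
        Tendsto
          (fun n : ℕ => ENNReal.ofReal
            (((1 / 3 : ℝ) ^ n)⁻¹ *
              formSum (Real.pi / 4) (vicsekConductance (paramH ϑ)) n g))
          atTop
          (𝓝 (limitEnergy (Real.pi / 4) (vicsekConductance (paramH ϑ)) (1 / 3) g))) ∧
      ∃ c : ℝ, 0 < c ∧
        ∀ f : Plane → ℂ,
          limitEnergy (Real.pi / 4) (vicsekConductance (paramH ϑ)) (1 / 3) (f ∘ deform ϑ) < ⊤ →
          ∃ Z : ℝ → ℝ,
            (∀ s : ℝ, 1 < s → HasTrace (zetaOperator ϑ f s) (Z s)) ∧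
            Tendsto (fun s : ℝ => (s - 1) * Z s) (𝓝[>] 1)
              (𝓝 (c * (limitEnergy (Real.pi / 4) (vicsekConductance (paramH ϑ)) (1 / 3)
                (f ∘ deform ϑ)).toReal))) ∧
    ∀ H : ℝ, 0 < H → ∃! ϑ : ℝ, ϑ ∈ Set.Ioo (0 : ℝ) (Real.pi / 2) ∧ paramH ϑ = H := by
  have hsquare : Real.pi / 4 ∈ Set.Ioo 0 (Real.pi / 2) := by
    constructor <;> linarith [Real.pi_pos]
  refine ⟨fun ϑ hϑ => ⟨deform_image_fractal ϑ,
    isEigenform_vicsekConductance hsquare (paramH_pos ϑ), tendsto_limitEnergy (paramH_pos ϑ) _,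
    energyRatio ϑ / Real.log 3, div_pos (energyRatio_pos hϑ) (Real.log_pos (by norm_num)),
    fun f hf => ?_⟩, fun H hH => existsUnique_paramH_eq hH⟩
  rw [limitEnergy_comp_deform] at hf ⊢
  rw [div_mul_eq_mul_div]
  exact exists_hasTrace_zetaOperator hϑ (tendsto_scaledSum_form_lengthConductance hϑ hf)

open RhombicVicsek in
theorem theorem3p3 :
    (∀ ϑ ∈ Set.Ioo (0 : ℝ) (Real.pi / 2),
      deform ϑ '' fractal (Real.pi / 4) = fractal ϑ ∧
      IsEigenform (Real.pi / 4) (vicsekConductance (paramH ϑ)) (1 / 3) ∧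
      (∀ g : Plane → ℂ, ContinuousOn g (fractal (Real.pi / 4)) →
        Tendsto
          (fun n : ℕ => ENNReal.ofReal
            (((1 / 3 : ℝ) ^ n)⁻¹ *
              formSum (Real.pi / 4) (vicsekConductance (paramH ϑ)) n g))
          atTop
          (𝓝 (limitEnergy (Real.pi / 4) (vicsekConductance (paramH ϑ)) (1 / 3) g))) ∧
      ∃ c : ℝ, 0 < c ∧
        ∀ f : Plane → ℂ, ContinuousOn f (fractal ϑ) →
          limitEnergy (Real.pi / 4) (vicsekConductance (paramH ϑ)) (1 / 3) (f ∘ deform ϑ) < ⊤ →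
          ∃ Z : ℝ → ℝ,
            (∀ s : ℝ, 1 < s → HasTrace (zetaOperator ϑ f s) (Z s)) ∧
            Tendsto (fun s : ℝ => (s - 1) * Z s) (𝓝[>] 1)
              (𝓝 (c * (limitEnergy (Real.pi / 4) (vicsekConductance (paramH ϑ)) (1 / 3)
                (f ∘ deform ϑ)).toReal))) ∧
    ∀ H : ℝ, 0 < H → ∃! ϑ : ℝ, ϑ ∈ Set.Ioo (0 : ℝ) (Real.pi / 2) ∧ paramH ϑ = H := by
  exact ⟨fun ϑ hϑ => have ⟨hK, hE, hlim, c, hc, hZ⟩ := theorem3p3_general.1 ϑ hϑ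
    ⟨hK, hE, fun g _ => hlim g, c, hc, fun f _ => hZ f⟩, theorem3p3_general.2⟩
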